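/- Let $n\ge 0$. Let $\mathrm{Bdp}_{n+1}$ be the symmetric monoidal category whose objects are pairs $(M,A)$ with $M$ a closed orientable smooth $n$-manifold and $A\subseteq M$ a finite set of basepoints which meets every connected component of $M$, and whose morphisms $(M_1,A_1)\to(M_2,A_2)$ are generated by the pairs $(W,A)$ with $W$ a compact orientable $(n+1)$-dimensional bordism from $M_1$ to $M_2$ and $A\subseteq W$ a finite set (non-empty unless $W=\emptyset$) with $A\cap M_i=A_i$, up to diffeomorphisms that respect the boundary identifications and the basepoints. Composition is gluing, thin bordisms (of length zero) serve as identities, and the monoidal product is disjoint union. A monoidal TQFT with basepoints, with values in the category $\mathrm{Mod}_R$ of modules over a commutative ring $R$, is a symmetric (strong) monoidal functor $\mathcal Z:\mathrm{Bdp}_{n+1}\to\mathrm{Mod}_R$. For a closed connected orientable $n$-manifold $M$ with one basepoint $p$, the twisting bordism is $\Theta_M=(M\times[0,1],\{(p,0),(p,1)\}):(M,\{p\})\to(M,\{p\})$; write $\Theta_M^2=\Theta_M\circ\Theta_M$. An element $t\in R$ is called a trace of an endomorphism $f$ of an $R$-module $V$ if there are $\varphi_i\in V^*$, $v_i\in V$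 (finitely many) with $f(v)=\sum_i\varphi_i(v)v_i$ for all $v$ and $t=\sum_i\varphi_i(v_i)$. Let $\mathcal Z:\mathrm{Bdp}_{n+1}\to\mathrm{Mod}_R$ be a monoidal TQFT with basepoints, and let $M$ be a closed connected orientable $n$-manifold with a basepoint $p$. (1) The endomorphism $\mathcal Z(\Theta_M^2)$ of $\mathcal Z(M,\{p\})$ has a trace $t\in R$ such that, for any two distinct points $x_1,x_2\in M\times S^1$, the map $\mathcal Z(M\times S^1,\{x_1,x_2\}):R\to R$ is multiplication by $t$. If $R$ is an integral domain or $\mathcal Z(M,\{p\})$ is a projective $R$-module, then $t$ is the only trace of $\mathcal Z(\Theta_M^2)$; if $\mathcal Z(M,\{p\})$ is free of finite rank, then $t=\operatorname{tr}\mathcal Z(\Theta_M^2)$ is the usual trace. (2) Suppose that $R$ is an integral domain and that $\mathcal Z$ is split with factor $\theta\in R$, i.e. $\mathcal Z(\Theta_N^2)=\theta\,\mathcal Z(\Theta_N)$ for every closed connected orientable $n$-manifold $N$ with one basepoint. Then there is an integer $m\ge 0$ such that, for any two distinct points $x_1,x_2\in M\times S^1$, the map $\mathcal Z(M\times S^1,\{x_1,x_2\}):R\to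 R$ is multiplication by $m\theta^2$. -/

import Mathlib

universe u

open CategoryTheory Set Topology

noncomputable section

section Manifolds

open scoped Manifold ContDiff

/-- A manifold is orientable if one can choose an orientation of every tangent space (recorded at `x`
by the sign of `ε x`, relative to the preferred chart at `x`) which is locally constant when it is
compared through the coordinate changes. -/
def IsOrientable {E H : Type*} [NormedAddCommGroup E] [NormedSpace ℝ E] [TopologicalSpace H]
    (I : ModelWithCorners ℝ E H) (M : Type*) [TopologicalSpace M] [ChartedSpace H M]
    [IsManifold I 1 M] : Prop :=
  ∃ ε : M → ℝ, ∀ x, ∀ᶠ y in 𝓝 x, 0 < ε x * ε y * (tangentCoordChange I x y y).det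

/-- A smooth map whose differential is injective at every point. -/
def IsSmoothImmersion {E E' H H' : Type*} [NormedAddCommGroup E] [NormedSpace ℝ E]
    [TopologicalSpace H] [NormedAddCommGroup E'] [NormedSpace ℝ E'] [TopologicalSpace H']
    (I : ModelWithCorners ℝ E H) (I' : ModelWithCorners ℝ E' H') {M N : Type*}
    [TopologicalSpace M] [ChartedSpace H M] [TopologicalSpace N] [ChartedSpace H' N]
    (f : M → N) : Prop :=
  ContMDiff I I' ∞ f ∧ ∀ x, Function.Injective (mfderiv I I' f x)

section Orientability

variable {E H E' H' : Type*} [NormedAddCommGroup E] [NormedSpace ℝ E] [TopologicalSpace H]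
  [NormedAddCommGroup E'] [NormedSpace ℝ E'] [TopologicalSpace H']
  {I : ModelWithCorners ℝ E H} {I' : ModelWithCorners ℝ E' H'}
  {M N : Type*} [TopologicalSpace M] [ChartedSpace H M] [IsManifold I 1 M]

theorem IsOrientable.of_isEmpty [IsEmpty M] : IsOrientable I M :=
  ⟨fun _ => 1, fun x => isEmptyElim x⟩

theorem tangentCoordChange_inl [TopologicalSpace N] [ChartedSpace H N] [IsManifold I 1 N]
    (x y z : M) : tangentCoordChange I (Sum.inl x : M ⊕ N) (Sum.inl y) (Sum.inl z) =
      tangentCoordChange I x y z := by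
  have : Nonempty H := nonempty_of_chartedSpace x
  have h : ∀ w : M, (chartAt H (Sum.inl w : M ⊕ N)) = (chartAt H w).lift_openEmbedding
      (X' := M ⊕ N) IsOpenEmbedding.inl := fun w => ChartedSpace.sum_chartAt_inl w
  simp only [tangentCoordChange_def]
  have key : (extChartAt I (Sum.inl y : M ⊕ N) ∘ (extChartAt I (Sum.inl x : M ⊕ N)).symm) =
      (extChartAt I y ∘ (extChartAt I x).symm) := by
    funext v
    simp [extChartAt, h, Sum.inl_injective.extend_apply]
  rw [key]
  congr 1
  simp 

theorem tangentCoordChange_inr [TopologicalSpace N] [ChartedSpace H N] [IsManifold I 1 N]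
    (x y z : N) : tangentCoordChange I (Sum.inr x : M ⊕ N) (Sum.inr y) (Sum.inr z) =
      tangentCoordChange I x y z := by
  have : Nonempty H := nonempty_of_chartedSpace x
  have h : ∀ w : N, (chartAt H (Sum.inr w : M ⊕ N)) = (chartAt H w).lift_openEmbedding
      (X' := M ⊕ N) IsOpenEmbedding.inr := fun w => ChartedSpace.sum_chartAt_inr w
  simp only [tangentCoordChange_def]
  have key : (extChartAt I (Sum.inr y : M ⊕ N) ∘ (extChartAt I (Sum.inr x : M ⊕ N)).symm) =
      (extChartAt I y ∘ (extChartAt I x).symm) := by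
    funext v
    simp [extChartAt, h, Sum.inr_injective.extend_apply]
  rw [key]
  congr 1
  simp 

theorem IsOrientable.sum [TopologicalSpace N] [ChartedSpace H N] [IsManifold I 1 N]
    (hM : IsOrientable I M) (hN : IsOrientable I N) : IsOrientable I (M ⊕ N) := by
  obtain ⟨a, ha⟩ := hM
  obtain ⟨b, hb⟩ := hN
  refine ⟨Sum.elim a b, ?_⟩
  rintro (x | x)
  · rw [nhds_inl, Filter.eventually_map]
    filter_upwards [ha x] with y hy
    rw [tangentCoordChange_inl]
    exact hy
  · rw [nhds_inr, Filter.eventually_map]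
    filter_upwards [hb x] with y hy
    rw [tangentCoordChange_inr]
    exact hy

theorem hasFDerivWithinAt_prodMap_mk {F F' : Type*} [NormedAddCommGroup F] [NormedSpace ℝ F]
    [NormedAddCommGroup F'] [NormedSpace ℝ F'] {f : F → F} {g : F' → F'} {s : Set F} {t : Set F'}
    {a : F} {b : F'} {f' : F →L[ℝ] F} {g' : F' →L[ℝ] F'} (hf : HasFDerivWithinAt f f' s a)
    (hg : HasFDerivWithinAt g g' t b) :
    HasFDerivWithinAt (Prod.map f g) (f'.prodMap g') (s ×ˢ t) (a, b) :=
  HasFDerivWithinAt.prodMap (a, b) (hf.mono (fst_image_prod_subset s t))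
    (hg.mono (snd_image_prod_subset s t))

theorem tangentCoordChange_prod [TopologicalSpace N] [ChartedSpace H' N] [IsManifold I' 1 N]
    (x y : M) (x' y' : N) (hy : y ∈ (extChartAt I x).source) (hy' : y' ∈ (extChartAt I' x').source) :
    tangentCoordChange (I.prod I') (x, x') (y, y') (y, y') =
      (tangentCoordChange I x y y).prodMap (tangentCoordChange I' x' y' y') := by
  have h1 := hasFDerivWithinAt_tangentCoordChange (I := I) (x := x) (y := y) (z := y)
    ⟨hy, mem_extChartAt_source y⟩
  have h2 := hasFDerivWithinAt_tangentCoordChange (I := I') (x := x') (y := y') (z := y')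
    ⟨hy', mem_extChartAt_source y'⟩
  have h3 := hasFDerivWithinAt_prodMap_mk h1 h2
  have h5 : range (I.prod I') = range I ×ˢ range I' := range_prodMap
  have h4 : UniqueDiffWithinAt ℝ (range I ×ˢ range I') (extChartAt I x y, extChartAt I' x' y') :=
    UniqueDiffWithinAt.prod (I.uniqueDiffOn _ (mem_range_self _))
      (I'.uniqueDiffOn _ (mem_range_self _))
  have h6 := h3.fderivWithin h4
  rw [tangentCoordChange_def, h5]
  rw [← h6]
  simp only [extChartAt_prod]
  rfl

theorem IsOrientable.prod [FiniteDimensional ℝ E] [FiniteDimensional ℝ E']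
    [TopologicalSpace N] [ChartedSpace H' N] [IsManifold I' 1 N]
    (hM : IsOrientable I M) (hN : IsOrientable I' N) : IsOrientable (I.prod I') (M × N) := by
  obtain ⟨a, ha⟩ := hM
  obtain ⟨b, hb⟩ := hN
  refine ⟨fun p => a p.1 * b p.2, ?_⟩
  rintro ⟨x, x'⟩
  have h1 := (ha x).and (extChartAt_source_mem_nhds (I := I) x)
  have h2 := (hb x').and (extChartAt_source_mem_nhds (I := I') x')
  filter_upwards [h1.prod_nhds h2] with y hy
  obtain ⟨⟨h3, h4⟩, h5, h6⟩ := hy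
  have h7 : (tangentCoordChange (I.prod I') (x, x') y y).det =
      (tangentCoordChange I x y.1 y.1).det * (tangentCoordChange I' x' y.2 y.2).det := by
    rw [show y = (y.1, y.2) from rfl, tangentCoordChange_prod x y.1 x' y.2 h4 h6]
    simp only [ContinuousLinearMap.det]
    exact LinearMap.det_prodMap _ _
  rw [h7]
  have := mul_pos h3 h5
  nlinarith [this]

theorem isOrientable_Icc : IsOrientable (𝓡∂ 1) (Icc (0 : ℝ) 1) := by
  refine ⟨fun x => if x.1 < 1 then 1 else -1, fun x => ?_⟩
  by_cases hx : x.1 < 1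
  · have : ∀ᶠ y : Icc (0 : ℝ) 1 in 𝓝 x, y.1 < 1 :=
      (isOpen_Iio.preimage continuous_subtype_val).mem_nhds hx
    filter_upwards [this] with y hy
    have h1 : achart (EuclideanHalfSpace 1) y = achart (EuclideanHalfSpace 1) x := by
      apply Subtype.ext
      simp [Icc_chartedSpaceChartAt, hx, hy]
    have h2 : tangentCoordChange (𝓡∂ 1) x y y = ContinuousLinearMap.id ℝ _ := by
      ext1 v
      simp only [tangentCoordChange, ← h1]
      exact tangentCoordChange_self (mem_extChartAt_source y)
    rw [h2]
    simp [hx, hy, ContinuousLinearMap.det]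
  · have hx1 : x.1 = 1 := le_antisymm x.2.2 (not_lt.1 hx)
    have : ∀ᶠ y : Icc (0 : ℝ) 1 in 𝓝 x, 0 < y.1 :=
      (isOpen_Ioi.preimage continuous_subtype_val).mem_nhds (by simp [hx1])
    filter_upwards [this] with y hy0
    by_cases hy : y.1 < 1
    · have h2 : tangentCoordChange (𝓡∂ 1) x y y = -ContinuousLinearMap.id ℝ _ := by
        rw [tangentCoordChange_def]
        refine HasFDerivWithinAt.fderivWithin ?_ ((𝓡∂ 1).uniqueDiffOn _ (mem_range_self _))
        have h3 : HasFDerivWithinAt (fun v : EuclideanSpace ℝ (Fin 1) =>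
            (WithLp.toLp 2 fun _ : Fin 1 => (1 : ℝ)) - v)
            (-ContinuousLinearMap.id ℝ _) (range (𝓡∂ 1)) (extChartAt (𝓡∂ 1) x y) :=
          ((hasFDerivAt_id _).const_sub _).hasFDerivWithinAt
        have hpt : ∀ v ∈ range (𝓡∂ 1), v 0 < 1 → (extChartAt (𝓡∂ 1) y ∘
            (extChartAt (𝓡∂ 1) x).symm) v = (WithLp.toLp 2 fun _ : Fin 1 => (1 : ℝ)) - v := by
          intro v hv' hv
          rw [range_modelWithCornersEuclideanHalfSpace] at hv'
          simp only [mem_ofPred_eq] at hv'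
          ext i
          fin_cases i
          simp [extChartAt, Icc_chartedSpaceChartAt, hx, hy, IccRightChart_symm_apply,
            IccLeftChart_apply, modelWithCornersEuclideanHalfSpace_symm_apply, hv', hv.le]
        have h0 : (extChartAt (𝓡∂ 1) x y) 0 < 1 := by
          simp [extChartAt, Icc_chartedSpaceChartAt, hx, IccRightChart_apply, hy0]
        refine h3.congr_of_eventuallyEq ?_ (hpt _ (mem_range_self _) h0)
        have h4 : {v : EuclideanSpace ℝ (Fin 1) | v 0 < 1} ∈
            𝓝[range (𝓡∂ 1)] (extChartAt (𝓡∂ 1) x y) :=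
          mem_nhdsWithin_of_mem_nhds ((isOpen_lt (by fun_prop) continuous_const).mem_nhds h0)
        filter_upwards [h4, self_mem_nhdsWithin] with v hv hv'
        exact hpt v hv' hv
      rw [h2]
      have h5 : LinearMap.det (-LinearMap.id : EuclideanSpace ℝ (Fin 1) →ₗ[ℝ] _) = -1 := by
        rw [show (-LinearMap.id : EuclideanSpace ℝ (Fin 1) →ₗ[ℝ] _) = (-1 : ℝ) • LinearMap.id by simp,
          LinearMap.det_smul]
        simp
      simp [hx, hy, ContinuousLinearMap.det, h5]
    · have hyx : y = x := Subtype.ext ((le_antisymm y.2.2 (not_lt.1 hy)).trans hx1.symm)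
      subst hyx
      have h2 : tangentCoordChange (𝓡∂ 1) y y y = ContinuousLinearMap.id ℝ _ := by
        ext1 v
        exact tangentCoordChange_self (mem_extChartAt_source y)
      rw [h2]
      simp [hx, ContinuousLinearMap.det]

end Orientability

section Immersions

variable {E H E' H' : Type*} [NormedAddCommGroup E] [NormedSpace ℝ E] [TopologicalSpace H]
  [NormedAddCommGroup E'] [NormedSpace ℝ E'] [TopologicalSpace H']
  {I : ModelWithCorners ℝ E H} {I' : ModelWithCorners ℝ E' H'}
  {M M₁ N N₁ : Type*} [TopologicalSpace M] [ChartedSpace H M] [TopologicalSpace M₁]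
  [ChartedSpace H M₁] [TopologicalSpace N] [ChartedSpace H' N] [TopologicalSpace N₁]
  [ChartedSpace H' N₁]

theorem IsSmoothImmersion.of_isEmpty [IsEmpty M] (f : M → N) : IsSmoothImmersion I I' f :=
  ⟨fun x => isEmptyElim x, fun x => isEmptyElim x⟩

theorem IsSmoothImmersion.of_diffeomorph (f : Diffeomorph I I M M₁ ∞) :
    IsSmoothImmersion I I f :=
  ⟨f.contMDiff, fun x => (f.mfderivToContinuousLinearEquiv (by simp) x).injective⟩

theorem IsSmoothImmersion.sumMap {f : M → N} {g : M₁ → N₁} (hf : IsSmoothImmersion I I' f)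
    (hg : IsSmoothImmersion I I' g) : IsSmoothImmersion I I' (Sum.map f g) := by
  refine ⟨hf.1.sumMap hg.1, ?_⟩
  have hs : MDifferentiable I I' (Sum.map f g) := (hf.1.sumMap hg.1).mdifferentiable (by simp)
  rintro (x | x)
  · have h1 := (hs (Sum.inl x)).hasMFDerivAt.comp x (hasMFDerivAt_inl (I := I) (M' := M₁) (q := x))
    have h2 := (hasMFDerivAt_inl (I := I') (M' := N₁) (q := f x)).comp x
      (hf.1.mdifferentiable (by simp) x).hasMFDerivAt
    have h3 := hasMFDerivAt_unique h1 h2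
    intro v w hvw
    exact hf.2 x
      ((DFunLike.congr_fun h3 v).symm.trans (Eq.trans hvw (DFunLike.congr_fun h3 w)))
  · have h1 := (hs (Sum.inr x)).hasMFDerivAt.comp x (hasMFDerivAt_inr (I := I) (M := M) (q' := x))
    have h2 := (hasMFDerivAt_inr (I := I') (M := N) (q' := g x)).comp x
      (hg.1.mdifferentiable (by simp) x).hasMFDerivAt
    have h3 := hasMFDerivAt_unique h1 h2
    intro v w hvw
    exact hg.2 x
      ((DFunLike.congr_fun h3 v).symm.trans (Eq.trans hvw (DFunLike.congr_fun h3 w)))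

theorem IsSmoothImmersion.prodMk_const (c : N) :
    IsSmoothImmersion I (I.prod I') (fun x : M => (x, c)) := by
  refine ⟨contMDiff_id.prodMk contMDiff_const, fun x v w hvw => ?_⟩
  have h := (hasMFDerivAt_id (I := I) x).prodMk (hasMFDerivAt_const (I := I) (I' := I') c x)
  have h2 : mfderiv I (I.prod I') (fun x : M => (x, c)) x = _ := h.mfderiv
  rw [h2] at hvw
  exact congrArg Prod.fst hvw

end Immersions

/-- A closed orientable smooth `n`-manifold with a finite set of basepoints which meets every
connected component. -/
structure PointedManifold (n : ℕ) where
  carrier : Type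
  [topology : TopologicalSpace carrier]
  [charted : ChartedSpace (EuclideanSpace ℝ (Fin n)) carrier]
  [smooth : IsManifold (𝓡 n) ∞ carrier]
  [compact : CompactSpace carrier]
  [hausdorff : T2Space carrier]
  orientable : IsOrientable (𝓡 n) carrier
  basepoints : Set carrier
  finite_basepoints : basepoints.Finite
  meets_component : ∀ x, ∃ a ∈ basepoints, a ∈ connectedComponent x

attribute [instance] PointedManifold.topology PointedManifold.charted PointedManifold.smooth
  PointedManifold.compact PointedManifold.hausdorff

namespace PointedManifold

variable {n : ℕ}

/-- The disjoint union. -/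
def sum (M N : PointedManifold n) : PointedManifold n where
  carrier := M.carrier ⊕ N.carrier
  orientable := M.orientable.sum N.orientable
  basepoints := {s | Sum.elim (· ∈ M.basepoints) (· ∈ N.basepoints) s}
  finite_basepoints := by
    refine ((M.finite_basepoints.image Sum.inl).union (N.finite_basepoints.image Sum.inr)).subset ?_
    rintro (x | x) hx
    · exact Or.inl ⟨x, hx, rfl⟩
    · exact Or.inr ⟨x, hx, rfl⟩
  meets_component := by
    rintro (x | x)
    · obtain ⟨a, ha, hax⟩ := M.meets_component x
      exact ⟨Sum.inl a, ha, continuous_inl.image_connectedComponent_subset x ⟨a, hax, rfl⟩⟩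
    · obtain ⟨a, ha, hax⟩ := N.meets_component x
      exact ⟨Sum.inr a, ha, continuous_inr.image_connectedComponent_subset x ⟨a, hax, rfl⟩⟩

/-- The empty manifold. -/
def empty (n : ℕ) : PointedManifold n :=
  letI : ChartedSpace (EuclideanSpace ℝ (Fin n)) Empty := ChartedSpace.empty _ _
  haveI : IsManifold (𝓡 n) ∞ Empty := IsManifold.empty ∞
  { carrier := Empty
    orientable := IsOrientable.of_isEmpty
    basepoints := ∅
    finite_basepoints := finite_empty
    meets_component := fun x => isEmptyElim x }

instance : IsEmpty (empty n).carrier := inferInstanceAs (IsEmpty Empty)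

/-- A closed connected orientable manifold `M` with the single basepoint `p`. -/
def single (M : Type) [TopologicalSpace M] [ChartedSpace (EuclideanSpace ℝ (Fin n)) M]
    [IsManifold (𝓡 n) ∞ M] [CompactSpace M] [T2Space M] [ConnectedSpace M]
    (hM : IsOrientable (𝓡 n) M) (p : M) : PointedManifold n where
  carrier := M
  orientable := hM
  basepoints := {p}
  finite_basepoints := finite_singleton p
  meets_component := fun x => ⟨p, rfl, by simp⟩

/-- A diffeomorphism which matches the basepoints. -/
structure Iso (M N : PointedManifold n) where
  toDiffeo : Diffeomorph (𝓡 n) (𝓡 n) M.carrier N.carrier ∞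
  mem_basepoints : ∀ x, toDiffeo x ∈ N.basepoints ↔ x ∈ M.basepoints

namespace Iso

variable {M N K L M' N' : PointedManifold n}

instance : CoeFun (Iso M N) (fun _ => M.carrier → N.carrier) := ⟨fun f => f.toDiffeo⟩

def refl (M : PointedManifold n) : Iso M M := ⟨Diffeomorph.refl _ _ _, fun _ => Iff.rfl⟩

def symm (f : Iso M N) : Iso N M :=
  ⟨f.toDiffeo.symm, fun x => by rw [← f.mem_basepoints, Diffeomorph.apply_symm_apply]⟩

def trans (f : Iso M N) (g : Iso N K) : Iso M K :=
  ⟨f.toDiffeo.trans g.toDiffeo, fun x => (g.mem_basepoints _).trans (f.mem_basepoints x)⟩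

def sumCongr (f : Iso M N) (g : Iso M' N') : Iso (M.sum M') (N.sum N') :=
  ⟨Diffeomorph.sumCongr f.toDiffeo g.toDiffeo, by
    rintro (x | x)
    · exact f.mem_basepoints x
    · exact g.mem_basepoints x⟩

def sumComm (M N : PointedManifold n) : Iso (M.sum N) (N.sum M) :=
  ⟨Diffeomorph.sumComm _ _ _ _, by rintro (x | x) <;> rfl⟩

def sumAssoc (M N K : PointedManifold n) : Iso ((M.sum N).sum K) (M.sum (N.sum K)) :=
  ⟨Diffeomorph.sumAssoc _ _ _ _ _, by rintro ((x | x) | x) <;> rfl⟩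

def sumEmpty (M : PointedManifold n) : Iso (M.sum (empty n)) M :=
  ⟨Diffeomorph.sumEmpty _ _ _, by
    rintro (x | x)
    · rfl
    · exact isEmptyElim (α := (empty n).carrier) x⟩

def emptySum (M : PointedManifold n) : Iso ((empty n).sum M) M :=
  (sumComm _ _).trans (sumEmpty M)

/-- The shuffle `(M ⊔ N) ⊔ (K ⊔ L) ≅ (M ⊔ K) ⊔ (N ⊔ L)`. -/
def shuffle (M N K L : PointedManifold n) :
    Iso ((M.sum N).sum (K.sum L)) ((M.sum K).sum (N.sum L)) :=
  ((sumAssoc M N _).trans ((refl M).sumCongr (((sumAssoc N K L).symm.trans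
    ((sumComm N K).sumCongr (refl L))).trans (sumAssoc K N L)))).trans (sumAssoc M K _).symm

@[simp] theorem refl_apply (x : M.carrier) : refl M x = x := rfl
@[simp] theorem trans_apply (f : Iso M N) (g : Iso N K) (x : M.carrier) :
    f.trans g x = g (f x) := rfl
@[simp] theorem apply_symm_apply (f : Iso M N) (x : N.carrier) : f (f.symm x) = x :=
  f.toDiffeo.apply_symm_apply x
@[simp] theorem symm_apply_apply (f : Iso M N) (x : M.carrier) : f.symm (f x) = x :=
  f.toDiffeo.symm_apply_apply x

theorem injective (f : Iso M N) : Function.Injective f := f.toDiffeo.injective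
theorem surjective (f : Iso M N) : Function.Surjective f := f.toDiffeo.surjective

end Iso

end PointedManifold

/-- The model `ℝⁿ × [0, ∞)` for `(n + 1)`-manifolds with boundary. -/
abbrev bordismModel (n : ℕ) : ModelWithCorners ℝ
    (EuclideanSpace ℝ (Fin n) × EuclideanSpace ℝ (Fin 1))
    (ModelProd (EuclideanSpace ℝ (Fin n)) (EuclideanHalfSpace 1)) :=
  (𝓡 n).prod (𝓡∂ 1)

/-- An `(n + 1)`-dimensional bordism with basepoints from `P` to `Q`: a compact orientable smooth
manifold whose boundary is identified with `P ⊔ Q`, and a finite set of basepoints, non-empty unless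
the manifold is empty, which restricts to the given basepoints of `P` and `Q`. -/
structure ThickBordism {n : ℕ} (P Q : PointedManifold n) where
  carrier : Type
  [topology : TopologicalSpace carrier]
  [charted : ChartedSpace (ModelProd (EuclideanSpace ℝ (Fin n)) (EuclideanHalfSpace 1)) carrier]
  [smooth : IsManifold (bordismModel n) ∞ carrier]
  [compact : CompactSpace carrier]
  [hausdorff : T2Space carrier]
  orientable : IsOrientable (bordismModel n) carrier
  inn : P.carrier → carrier
  out : Q.carrier → carrier
  inn_immersion : IsSmoothImmersion (𝓡 n) (bordismModel n) inn
  out_immersion : IsSmoothImmersion (𝓡 n) (bordismModel n) out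
  inn_injective : Function.Injective inn
  out_injective : Function.Injective out
  inn_ne_out : ∀ p q, inn p ≠ out q
  boundary_eq : (bordismModel n).boundary carrier = range inn ∪ range out
  basepoints : Set carrier
  finite_basepoints : basepoints.Finite
  nonempty_basepoints : Nonempty carrier → basepoints.Nonempty
  inn_mem : ∀ p, inn p ∈ basepoints ↔ p ∈ P.basepoints
  out_mem : ∀ q, out q ∈ basepoints ↔ q ∈ Q.basepoints

attribute [instance] ThickBordism.topology ThickBordism.charted ThickBordism.smooth
  ThickBordism.compact ThickBordism.hausdorff

namespace ThickBordism

variable {n : ℕ} {P Q P' Q' : PointedManifold n}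

/-- The empty bordism. -/
def empty (n : ℕ) : ThickBordism (PointedManifold.empty n) (PointedManifold.empty n) :=
  letI : ChartedSpace (ModelProd (EuclideanSpace ℝ (Fin n)) (EuclideanHalfSpace 1)) Empty :=
    ChartedSpace.empty _ _
  haveI : IsManifold (bordismModel n) ∞ Empty := IsManifold.empty ∞
  { carrier := Empty
    orientable := IsOrientable.of_isEmpty
    inn := fun x => isEmptyElim x
    out := fun x => isEmptyElim x
    inn_immersion := IsSmoothImmersion.of_isEmpty _
    out_immersion := IsSmoothImmersion.of_isEmpty _
    inn_injective := fun x => isEmptyElim x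
    out_injective := fun x => isEmptyElim x
    inn_ne_out := fun x => isEmptyElim x
    boundary_eq := Set.ext fun x => isEmptyElim x
    basepoints := ∅
    finite_basepoints := finite_empty
    nonempty_basepoints := fun ⟨x⟩ => isEmptyElim x
    inn_mem := fun x => isEmptyElim x
    out_mem := fun x => isEmptyElim x }

instance : IsEmpty (empty n).carrier := inferInstanceAs (IsEmpty Empty)

/-- The disjoint union of two bordisms. -/
def sum (W : ThickBordism P Q) (W' : ThickBordism P' Q') :
    ThickBordism (P.sum P') (Q.sum Q') where
  carrier := W.carrier ⊕ W'.carrier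
  orientable := W.orientable.sum W'.orientable
  inn := Sum.map W.inn W'.inn
  out := Sum.map W.out W'.out
  inn_immersion := W.inn_immersion.sumMap W'.inn_immersion
  out_immersion := W.out_immersion.sumMap W'.out_immersion
  inn_injective := Sum.map_injective.2 ⟨W.inn_injective, W'.inn_injective⟩
  out_injective := Sum.map_injective.2 ⟨W.out_injective, W'.out_injective⟩
  inn_ne_out := by
    rintro (p | p) (q | q) h
    · exact W.inn_ne_out p q (Sum.inl_injective h)
    · exact Sum.inl_ne_inr h
    · exact Sum.inr_ne_inl h
    · exact W'.inn_ne_out p q (Sum.inr_injective h)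
  boundary_eq := by
    rw [ModelWithCorners.boundary_disjointUnion, W.boundary_eq, W'.boundary_eq]
    simp only [PointedManifold.sum]
    ext (x | x) <;> simp
  basepoints := {s | Sum.elim (· ∈ W.basepoints) (· ∈ W'.basepoints) s}
  finite_basepoints := by
    refine ((W.finite_basepoints.image Sum.inl).union (W'.finite_basepoints.image Sum.inr)).subset ?_
    rintro (x | x) hx
    · exact Or.inl ⟨x, hx, rfl⟩
    · exact Or.inr ⟨x, hx, rfl⟩
  nonempty_basepoints := by
    rintro ⟨x | x⟩
    · obtain ⟨a, ha⟩ := W.nonempty_basepoints ⟨x⟩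
      exact ⟨Sum.inl a, ha⟩
    · obtain ⟨a, ha⟩ := W'.nonempty_basepoints ⟨x⟩
      exact ⟨Sum.inr a, ha⟩
  inn_mem := by
    rintro (p | p)
    · exact W.inn_mem p
    · exact W'.inn_mem p
  out_mem := by
    rintro (p | p)
    · exact W.out_mem p
    · exact W'.out_mem p

/-- The cylinder `M × [0, 1]`, whose basepoints are those of the two ends. -/
def cylinder (M : PointedManifold n) : ThickBordism M M where
  carrier := M.carrier × Icc (0 : ℝ) 1
  orientable := M.orientable.prod isOrientable_Icc
  inn := fun x => (x, 0)
  out := fun x => (x, 1)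
  inn_immersion := IsSmoothImmersion.prodMk_const _
  out_immersion := IsSmoothImmersion.prodMk_const _
  inn_injective := fun _ _ h => congrArg Prod.fst h
  out_injective := fun _ _ h => congrArg Prod.fst h
  inn_ne_out := fun p q h => zero_ne_one (congrArg Prod.snd h)
  boundary_eq := by
    rw [boundary_product]
    ext ⟨x, t⟩
    have h0 : (⊥ : Icc (0 : ℝ) 1) = 0 := rfl
    have h1 : (⊤ : Icc (0 : ℝ) 1) = 1 := rfl
    simp [Set.prod, h0, h1, eq_comm]
  basepoints := M.basepoints ×ˢ {0, 1}
  finite_basepoints := M.finite_basepoints.prod (by simp)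
  nonempty_basepoints := by
    rintro ⟨x, _⟩
    obtain ⟨a, ha, -⟩ := M.meets_component x
    exact ⟨(a, 0), ha, by simp⟩
  inn_mem := fun p => by simp
  out_mem := fun p => by simp

end ThickBordism

/-- A morphism `M → L` of the bordism category which is presented by a single bordism. Since the
identities are thin, such a bordism is the disjoint union of a genuine bordism `thick` and
of a thin part, i.e. of a manifold `N` which is regarded as a bordism of length zero from itself to
itself; its two ends are identified with `M` and `L`. -/
structure Bordism {n : ℕ} (M L : PointedManifold n) where
  P : PointedManifold n
  Q : PointedManifold n
  N : PointedManifold n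
  thick : ThickBordism P Q
  e₁ : M.Iso (P.sum N)
  e₂ : L.Iso (Q.sum N)

namespace Bordism

variable {n : ℕ} {M L K M' L' K' : PointedManifold n}

/-- The underlying set of a bordism: the union of the thick and of the thin part. -/
abbrev Total (X : Bordism M L) : Type := X.thick.carrier ⊕ X.N.carrier

/-- The inclusion of the incoming boundary. -/
def inn (X : Bordism M L) (m : M.carrier) : X.Total := Sum.map X.thick.inn id (X.e₁ m)

/-- The inclusion of the outgoing boundary. -/
def out (X : Bordism M L) (l : L.carrier) : X.Total := Sum.map X.thick.out id (X.e₂ l)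

/-- The basepoints of a bordism. -/
def basepoints (X : Bordism M L) : Set X.Total :=
  {x | Sum.elim (· ∈ X.thick.basepoints) (· ∈ X.N.basepoints) x}

/-- A bordism without thin part. -/
def ofThick (W : ThickBordism M L) : Bordism M L :=
  ⟨M, L, .empty n, W, (PointedManifold.Iso.sumEmpty M).symm, (PointedManifold.Iso.sumEmpty L).symm⟩

/-- The thin bordism given by a basepoint preserving diffeomorphism. -/
def thin (f : M.Iso L) : Bordism M L :=
  ⟨.empty n, .empty n, M, .empty n, (PointedManifold.Iso.emptySum M).symm,
    f.symm.trans (PointedManifold.Iso.emptySum M).symm⟩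

/-- The disjoint union of two bordisms. -/
def sum (X : Bordism M L) (Y : Bordism M' L') : Bordism (M.sum M') (L.sum L') :=
  ⟨X.P.sum Y.P, X.Q.sum Y.Q, X.N.sum Y.N, X.thick.sum Y.thick,
    (X.e₁.sumCongr Y.e₁).trans (.shuffle _ _ _ _), (X.e₂.sumCongr Y.e₂).trans (.shuffle _ _ _ _)⟩

/-- A bordism without thick part whose two boundary inclusions agree: a thin identity. -/
def IsIdentity (X : Bordism M M) : Prop :=
  IsEmpty X.thick.carrier ∧ ∀ m, X.inn m = X.out m

/-- The map between total spaces given by a map of the thick parts and a map on the thin part. -/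
abbrev totalMap {X : Bordism M L} {Z : Bordism M' L'} (f : X.thick.carrier → Z.thick.carrier)
    (g : X.N.carrier → Z.Total) : X.Total → Z.Total := Sum.elim (Sum.inl ∘ f) g

/-- The data which exhibit `Z : M → K` as the result of gluing `X : M → L` and `Y : L → K` along `L`:
injections of `X` and `Y` into `Z`, smooth immersions on the thick parts (which have the same
dimension as the thick part of `Z`), which cover `Z`, meet exactly along `L`, and respect
the remaining boundaries and the basepoints. -/
structure Gluing (X : Bordism M L) (Y : Bordism L K) (Z : Bordism M K) where
  aThick : X.thick.carrier → Z.thick.carrier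
  aThin : X.N.carrier → Z.Total
  bThick : Y.thick.carrier → Z.thick.carrier
  bThin : Y.N.carrier → Z.Total
  a_immersion : IsSmoothImmersion (bordismModel n) (bordismModel n) aThick
  b_immersion : IsSmoothImmersion (bordismModel n) (bordismModel n) bThick
  a_injective : Function.Injective (totalMap aThick aThin)
  b_injective : Function.Injective (totalMap bThick bThin)
  cover : ∀ z, (∃ x, totalMap aThick aThin x = z) ∨ ∃ y, totalMap bThick bThin y = z
  meet : ∀ x y, totalMap aThick aThin x = totalMap bThick bThin y ↔
    ∃ l, X.out l = x ∧ Y.inn l = y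
  inn_eq : ∀ m, Z.inn m = totalMap aThick aThin (X.inn m)
  out_eq : ∀ k, Z.out k = totalMap bThick bThin (Y.out k)
  basepoints_eq : ∀ z, z ∈ Z.basepoints ↔ (∃ x ∈ X.basepoints, totalMap aThick aThin x = z) ∨
    ∃ y ∈ Y.basepoints, totalMap bThick bThin y = z

section Lemmas

theorem inn_injective (X : Bordism M L) : Function.Injective X.inn :=
  (Sum.map_injective.2 ⟨X.thick.inn_injective, Function.injective_id⟩).comp X.e₁.injective

theorem out_injective (X : Bordism M L) : Function.Injective X.out :=
  (Sum.map_injective.2 ⟨X.thick.out_injective, Function.injective_id⟩).comp X.e₂.injective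

theorem inn_mem (X : Bordism M L) (m : M.carrier) : X.inn m ∈ X.basepoints ↔ m ∈ M.basepoints := by
  rw [← X.e₁.mem_basepoints]
  unfold inn basepoints
  rcases X.e₁ m with (p | p)
  · exact X.thick.inn_mem p
  · rfl

theorem out_mem (X : Bordism M L) (l : L.carrier) : X.out l ∈ X.basepoints ↔ l ∈ L.basepoints := by
  rw [← X.e₂.mem_basepoints]
  unfold out basepoints
  rcases X.e₂ l with (p | p)
  · exact X.thick.out_mem p
  · rfl

/-- The inclusion of the first summand of a disjoint union. -/
def sumInl (X : Bordism M L) (Y : Bordism M' L') : X.Total → (X.sum Y).Total :=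
  Sum.map Sum.inl Sum.inl

/-- The inclusion of the second summand of a disjoint union. -/
def sumInr (X : Bordism M L) (Y : Bordism M' L') : Y.Total → (X.sum Y).Total :=
  Sum.map Sum.inr Sum.inr

theorem sum_inn_inl (X : Bordism M L) (Y : Bordism M' L') (m : M.carrier) :
    (X.sum Y).inn (Sum.inl m) = X.sumInl Y (X.inn m) := by
  change Sum.map _ id (PointedManifold.Iso.shuffle _ _ _ _ (Sum.inl (X.e₁ m))) = _
  unfold inn
  rcases X.e₁ m with p | p <;> rfl

theorem sum_inn_inr (X : Bordism M L) (Y : Bordism M' L') (m : M'.carrier) :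
    (X.sum Y).inn (Sum.inr m) = X.sumInr Y (Y.inn m) := by
  change Sum.map _ id (PointedManifold.Iso.shuffle _ _ _ _ (Sum.inr (Y.e₁ m))) = _
  unfold inn
  rcases Y.e₁ m with p | p <;> rfl

theorem sum_out_inl (X : Bordism M L) (Y : Bordism M' L') (m : L.carrier) :
    (X.sum Y).out (Sum.inl m) = X.sumInl Y (X.out m) := by
  change Sum.map _ id (PointedManifold.Iso.shuffle _ _ _ _ (Sum.inl (X.e₂ m))) = _
  unfold out
  rcases X.e₂ m with p | p <;> rfl

theorem sum_out_inr (X : Bordism M L) (Y : Bordism M' L') (m : L'.carrier) :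
    (X.sum Y).out (Sum.inr m) = X.sumInr Y (Y.out m) := by
  change Sum.map _ id (PointedManifold.Iso.shuffle _ _ _ _ (Sum.inr (Y.e₂ m))) = _
  unfold out
  rcases Y.e₂ m with p | p <;> rfl

theorem thin_inn (f : M.Iso L) (m : M.carrier) : (thin f).inn m = Sum.inr m := rfl

theorem thin_out (f : M.Iso L) (l : L.carrier) : (thin f).out l = Sum.inr (f.symm l) := rfl

theorem isIdentity_thin_refl (M : PointedManifold n) : (thin (.refl M)).IsIdentity :=
  ⟨inferInstanceAs (IsEmpty (ThickBordism.empty n).carrier), fun _ => rfl⟩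

theorem IsIdentity.sum {X : Bordism M M} {Y : Bordism L L} (hX : X.IsIdentity) (hY : Y.IsIdentity) :
    (X.sum Y).IsIdentity := by
  have h1 := hX.1
  have h2 := hY.1
  refine ⟨inferInstanceAs (IsEmpty (X.thick.carrier ⊕ Y.thick.carrier)), ?_⟩
  rintro (m | m)
  · exact (sum_inn_inl X Y m).trans ((congrArg _ (hX.2 m)).trans (sum_out_inl X Y m).symm)
  · exact (sum_inn_inr X Y m).trans ((congrArg _ (hY.2 m)).trans (sum_out_inr X Y m).symm)

/-- Cases on the points of a disjoint union of bordisms. -/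
theorem sum_cases {X : Bordism M L} {Y : Bordism M' L'} (z : (X.sum Y).Total) :
    (∃ x, X.sumInl Y x = z) ∨ ∃ y, X.sumInr Y y = z := by
  rcases z with (x | y) | (x | y)
  · exact Or.inl ⟨Sum.inl x, rfl⟩
  · exact Or.inr ⟨Sum.inl y, rfl⟩
  · exact Or.inl ⟨Sum.inr x, rfl⟩
  · exact Or.inr ⟨Sum.inr y, rfl⟩

theorem sumInl_injective (X : Bordism M L) (Y : Bordism M' L') :
    Function.Injective (X.sumInl Y) :=
  Sum.map_injective.2 ⟨Sum.inl_injective, Sum.inl_injective⟩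

theorem sumInr_injective (X : Bordism M L) (Y : Bordism M' L') :
    Function.Injective (X.sumInr Y) :=
  Sum.map_injective.2 ⟨Sum.inr_injective, Sum.inr_injective⟩

theorem sumInl_ne_sumInr {X : Bordism M L} {Y : Bordism M' L'} (x : X.Total) (y : Y.Total) :
    X.sumInl Y x ≠ X.sumInr Y y := by
  intro h
  rcases x with x | x <;> rcases y with y | y
  · exact Sum.inl_ne_inr (Sum.inl_injective h)
  · exact Sum.inl_ne_inr h
  · exact Sum.inr_ne_inl h
  · exact Sum.inl_ne_inr (Sum.inr_injective h)

theorem sumInl_mem {X : Bordism M L} {Y : Bordism M' L'} (x : X.Total) :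
    X.sumInl Y x ∈ (X.sum Y).basepoints ↔ x ∈ X.basepoints := by
  rcases x with x | x <;> rfl

theorem sumInr_mem {X : Bordism M L} {Y : Bordism M' L'} (y : Y.Total) :
    X.sumInr Y y ∈ (X.sum Y).basepoints ↔ y ∈ Y.basepoints := by
  rcases y with y | y <;> rfl

/-- Disjoint unions of gluings are gluings. -/
theorem Gluing.sum {X : Bordism M L} {Y : Bordism L K} {Z : Bordism M K} {X' : Bordism M' L'}
    {Y' : Bordism L' K'} {Z' : Bordism M' K'} (g : Gluing X Y Z) (g' : Gluing X' Y' Z') :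
    Nonempty (Gluing (X.sum X') (Y.sum Y') (Z.sum Z')) := by
  let a : (X.sum X').thick.carrier → (Z.sum Z').thick.carrier := Sum.map g.aThick g'.aThick
  let b : (Y.sum Y').thick.carrier → (Z.sum Z').thick.carrier := Sum.map g.bThick g'.bThick
  let α : (X.sum X').N.carrier → (Z.sum Z').Total :=
    Sum.elim (Z.sumInl Z' ∘ g.aThin) (Z.sumInr Z' ∘ g'.aThin)
  let β : (Y.sum Y').N.carrier → (Z.sum Z').Total :=
    Sum.elim (Z.sumInl Z' ∘ g.bThin) (Z.sumInr Z' ∘ g'.bThin)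
  have al : ∀ x, totalMap a α (X.sumInl X' x) = Z.sumInl Z' (totalMap g.aThick g.aThin x) := by
    rintro (x | x) <;> rfl
  have ar : ∀ x, totalMap a α (X.sumInr X' x) = Z.sumInr Z' (totalMap g'.aThick g'.aThin x) := by
    rintro (x | x) <;> rfl
  have bl : ∀ x, totalMap b β (Y.sumInl Y' x) = Z.sumInl Z' (totalMap g.bThick g.bThin x) := by
    rintro (x | x) <;> rfl
  have br : ∀ x, totalMap b β (Y.sumInr Y' x) = Z.sumInr Z' (totalMap g'.bThick g'.bThin x) := by
    rintro (x | x) <;> rfl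
  refine ⟨⟨a, α, b, β, g.a_immersion.sumMap g'.a_immersion, g.b_immersion.sumMap g'.b_immersion,
    ?_, ?_, ?_, ?_, ?_, ?_, ?_⟩⟩
  · intro x y h
    rcases sum_cases x with ⟨x, rfl⟩ | ⟨x, rfl⟩ <;> rcases sum_cases y with ⟨y, rfl⟩ | ⟨y, rfl⟩
    · rw [al, al] at h
      rw [g.a_injective (sumInl_injective _ _ h)]
    · rw [al, ar] at h
      exact absurd h (sumInl_ne_sumInr _ _)
    · rw [al, ar] at h
      exact absurd h.symm (sumInl_ne_sumInr _ _)
    · rw [ar, ar] at h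
      rw [g'.a_injective (sumInr_injective _ _ h)]
  · intro x y h
    rcases sum_cases x with ⟨x, rfl⟩ | ⟨x, rfl⟩ <;> rcases sum_cases y with ⟨y, rfl⟩ | ⟨y, rfl⟩
    · rw [bl, bl] at h
      rw [g.b_injective (sumInl_injective _ _ h)]
    · rw [bl, br] at h
      exact absurd h (sumInl_ne_sumInr _ _)
    · rw [bl, br] at h
      exact absurd h.symm (sumInl_ne_sumInr _ _)
    · rw [br, br] at h
      rw [g'.b_injective (sumInr_injective _ _ h)]
  · intro z
    rcases sum_cases z with ⟨z, rfl⟩ | ⟨z, rfl⟩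
    · rcases g.cover z with ⟨x, rfl⟩ | ⟨y, rfl⟩
      · exact Or.inl ⟨_, al x⟩
      · exact Or.inr ⟨_, bl y⟩
    · rcases g'.cover z with ⟨x, rfl⟩ | ⟨y, rfl⟩
      · exact Or.inl ⟨_, ar x⟩
      · exact Or.inr ⟨_, br y⟩
  · intro x y
    constructor
    · intro h
      rcases sum_cases x with ⟨x, rfl⟩ | ⟨x, rfl⟩ <;> rcases sum_cases y with ⟨y, rfl⟩ | ⟨y, rfl⟩
      · rw [al, bl] at h
        obtain ⟨l, rfl, rfl⟩ := (g.meet _ _).1 (sumInl_injective _ _ h)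
        exact ⟨Sum.inl l, sum_out_inl _ _ _, sum_inn_inl _ _ _⟩
      · rw [al, br] at h
        exact absurd h (sumInl_ne_sumInr _ _)
      · rw [bl, ar] at h
        exact absurd h.symm (sumInl_ne_sumInr _ _)
      · rw [ar, br] at h
        obtain ⟨l, rfl, rfl⟩ := (g'.meet _ _).1 (sumInr_injective _ _ h)
        exact ⟨Sum.inr l, sum_out_inr _ _ _, sum_inn_inr _ _ _⟩
    · rintro ⟨l | l, rfl, rfl⟩
      · rw [sum_out_inl, sum_inn_inl, al, bl, (g.meet _ _).2 ⟨l, rfl, rfl⟩]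
      · rw [sum_out_inr, sum_inn_inr, ar, br, (g'.meet _ _).2 ⟨l, rfl, rfl⟩]
  · rintro (m | m)
    · rw [sum_inn_inl, sum_inn_inl, al, g.inn_eq]
    · rw [sum_inn_inr, sum_inn_inr, ar, g'.inn_eq]
  · rintro (m | m)
    · rw [sum_out_inl, sum_out_inl, bl, g.out_eq]
    · rw [sum_out_inr, sum_out_inr, br, g'.out_eq]
  · intro z
    rcases sum_cases z with ⟨z, rfl⟩ | ⟨z, rfl⟩
    · rw [sumInl_mem, g.basepoints_eq]
      constructor
      · rintro (⟨x, hx, rfl⟩ | ⟨y, hy, rfl⟩)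
        · exact Or.inl ⟨_, (sumInl_mem x).2 hx, al x⟩
        · exact Or.inr ⟨_, (sumInl_mem y).2 hy, bl y⟩
      · rintro (⟨x, hx, h⟩ | ⟨x, hx, h⟩) <;> rcases sum_cases x with ⟨x, rfl⟩ | ⟨x, rfl⟩
        · exact Or.inl ⟨x, (sumInl_mem x).1 hx, sumInl_injective _ _ ((al x).symm.trans h)⟩
        · exact absurd (h.symm.trans (ar x)) (sumInl_ne_sumInr _ _)
        · exact Or.inr ⟨x, (sumInl_mem x).1 hx, sumInl_injective _ _ ((bl x).symm.trans h)⟩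
        · exact absurd (h.symm.trans (br x)) (sumInl_ne_sumInr _ _)
    · rw [sumInr_mem, g'.basepoints_eq]
      constructor
      · rintro (⟨x, hx, rfl⟩ | ⟨y, hy, rfl⟩)
        · exact Or.inl ⟨_, (sumInr_mem x).2 hx, ar x⟩
        · exact Or.inr ⟨_, (sumInr_mem y).2 hy, br y⟩
      · rintro (⟨x, hx, h⟩ | ⟨x, hx, h⟩) <;> rcases sum_cases x with ⟨x, rfl⟩ | ⟨x, rfl⟩
        · exact absurd ((al x).symm.trans h) (sumInl_ne_sumInr _ _)
        · exact Or.inl ⟨x, (sumInr_mem x).1 hx, sumInr_injective _ _ ((ar x).symm.trans h)⟩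
        · exact absurd ((bl x).symm.trans h) (sumInl_ne_sumInr _ _)
        · exact Or.inr ⟨x, (sumInr_mem x).1 hx, sumInr_injective _ _ ((br x).symm.trans h)⟩

/-- A diffeomorphism of bordisms `X : M → L` and `Y : M' → L'` which restricts to given
diffeomorphisms of the boundaries. -/
structure DiffeoOver (X : Bordism M L) (Y : Bordism M' L') (f : M.Iso M') (g : L.Iso L') where
  thick : Diffeomorph (bordismModel n) (bordismModel n) X.thick.carrier Y.thick.carrier ∞
  thin : X.N.carrier ≃ Y.N.carrier
  inn_eq : ∀ m, Y.inn (f m) = Sum.map thick thin (X.inn m)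
  out_eq : ∀ l, Y.out (g l) = Sum.map thick thin (X.out l)
  mem_iff : ∀ x, Sum.map thick thin x ∈ Y.basepoints ↔ x ∈ X.basepoints

/-- Precomposition of the incoming boundary identification with a diffeomorphism. -/
def precomp (f : M.Iso M') (Y : Bordism M' L') : Bordism M L' :=
  ⟨Y.P, Y.Q, Y.N, Y.thick, f.trans Y.e₁, Y.e₂⟩

theorem gluing_thin_left (f : M.Iso M') (Y : Bordism M' L') :
    Nonempty (Gluing (thin f) Y (precomp f Y)) := by
  have he : IsEmpty (thin f).thick.carrier := inferInstanceAs (IsEmpty (ThickBordism.empty n).carrier)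
  let a : (thin f).thick.carrier → (precomp f Y).thick.carrier := fun x => isEmptyElim x
  let α : (thin f).N.carrier → (precomp f Y).Total := fun m => Y.inn (f m)
  let b : Y.thick.carrier → (precomp f Y).thick.carrier := id
  let β : Y.N.carrier → (precomp f Y).Total := Sum.inr
  have hb : ∀ y, totalMap b β y = y := by rintro (y | y) <;> rfl
  have ha : ∀ m : M.carrier, totalMap a α (Sum.inr m) = Y.inn (f m) := fun _ => rfl
  refine ⟨⟨a, α, b, β, IsSmoothImmersion.of_isEmpty _,
    IsSmoothImmersion.of_diffeomorph (Diffeomorph.refl _ _ _), ?_, ?_, ?_, ?_, ?_, ?_, ?_⟩⟩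
  · rintro (x | x) (y | y) h
    · exact he.elim x
    · exact he.elim x
    · exact he.elim y
    · exact congrArg Sum.inr (f.injective (Y.inn_injective h))
  · intro x y h
    rwa [hb, hb] at h
  · exact fun z => Or.inr ⟨z, hb z⟩
  · rintro (x | x) y
    · exact he.elim x
    · rw [hb]
      constructor
      · rintro h
        exact ⟨f x, congrArg Sum.inr (f.symm_apply_apply x), h⟩
      · rintro ⟨l, hl, rfl⟩
        have : f.symm l = x := Sum.inr_injective hl
        subst this
        exact congrArg Y.inn (f.apply_symm_apply l)
  · exact fun _ => rfl
  · exact fun k => (hb _).symm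
  · intro z
    constructor
    · exact fun h => Or.inr ⟨z, h, hb z⟩
    · rintro (⟨x | x, hx, rfl⟩ | ⟨y, hy, rfl⟩)
      · exact he.elim x
      · exact (Y.inn_mem (f x)).2 ((f.mem_basepoints x).2 hx)
      · rw [hb]
        exact hy

theorem DiffeoOver.gluing {X : Bordism M L} {Y : Bordism M' L'} {f : M.Iso M'} {g : L.Iso L'}
    (φ : DiffeoOver X Y f g) : Nonempty (Gluing X (Bordism.thin g) (precomp f Y)) := by
  have he : IsEmpty (Bordism.thin g).thick.carrier :=
    inferInstanceAs (IsEmpty (ThickBordism.empty n).carrier)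
  let a : X.thick.carrier → (precomp f Y).thick.carrier := φ.thick
  let α : X.N.carrier → (precomp f Y).Total := Sum.inr ∘ φ.thin
  let b : (Bordism.thin g).thick.carrier → (precomp f Y).thick.carrier := fun x => isEmptyElim x
  let β : (Bordism.thin g).N.carrier → (precomp f Y).Total := fun l => Y.out (g l)
  have ha : ∀ x, totalMap a α x = Sum.map φ.thick φ.thin x := by rintro (x | x) <;> rfl
  refine ⟨⟨a, α, b, β, IsSmoothImmersion.of_diffeomorph φ.thick,
    IsSmoothImmersion.of_isEmpty _, ?_, ?_, ?_, ?_, ?_, ?_, ?_⟩⟩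
  · intro x y h
    rw [ha, ha] at h
    exact Sum.map_injective.2 ⟨φ.thick.injective, φ.thin.injective⟩ h
  · rintro (x | x) (y | y) h
    · exact he.elim x
    · exact he.elim x
    · exact he.elim y
    · exact congrArg Sum.inr (g.injective (Y.out_injective h))
  · intro z
    obtain ⟨x, hx⟩ := Sum.map_surjective.2 ⟨φ.thick.surjective, φ.thin.surjective⟩ z
    exact Or.inl ⟨x, (ha x).trans hx⟩
  · rintro x (y | y)
    · exact he.elim y
    · rw [ha]
      constructor
      · intro h
        refine ⟨y, ?_, rfl⟩
        have h' := (φ.out_eq y).symm.trans h.symm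
        exact Sum.map_injective.2 ⟨φ.thick.injective, φ.thin.injective⟩ h'
      · rintro ⟨l, rfl, hl⟩
        have : l = y := Sum.inr_injective hl
        subst this
        exact (φ.out_eq l).symm
  · exact fun m => (φ.inn_eq m).trans (ha _).symm
  · exact fun k => (congrArg Y.out (g.apply_symm_apply k)).symm
  · intro z
    constructor
    · intro h
      obtain ⟨x, rfl⟩ := Sum.map_surjective.2 ⟨φ.thick.surjective, φ.thin.surjective⟩ z
      exact Or.inl ⟨x, (φ.mem_iff x).1 h, ha x⟩
    · rintro (⟨x, hx, rfl⟩ | ⟨y | y, hy, rfl⟩)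
      · rw [ha]
        exact (φ.mem_iff x).2 hx
      · exact he.elim y
      · exact (Y.out_mem (g y)).2 ((g.mem_basepoints y).2 hy)

end Lemmas

end Bordism

end Manifolds

/-! ## The category of bordisms with basepoints -/

instance (n : ℕ) : Quiver (PointedManifold n) := ⟨Bordism⟩

/-- The relations between strings of composable bordisms: two consecutive bordisms may be replaced by
any bordism which is obtained by gluing them, and a thin identity may be deleted. -/
inductive GluingRel (n : ℕ) : HomRel (Paths (PointedManifold n))
  | glue {M L K : PointedManifold n} (X : Bordism M L) (Y : Bordism L K) (Z : Bordism M K)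
      (h : Nonempty (Bordism.Gluing X Y Z)) :
      GluingRel n ((Paths.of (PointedManifold n)).map (X : M ⟶ L) ≫
        (Paths.of (PointedManifold n)).map (Y : L ⟶ K))
        ((Paths.of (PointedManifold n)).map (Z : M ⟶ K))
  | ident {M : PointedManifold n} (X : Bordism M M) (h : X.IsIdentity) :
      GluingRel n ((Paths.of (PointedManifold n)).map (X : M ⟶ M))
        (𝟙 ((Paths.of (PointedManifold n)).obj M))

/-- The category of `(n + 1)`-dimensional bordisms with basepoints: its objects are closed
`n`-manifolds with basepoints, its morphisms are generated by the bordisms, and composition is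
gluing. -/
structure Bdp (n : ℕ) where of ::
  as : PointedManifold n

namespace Bdp

variable {n : ℕ}

/-- The morphisms: strings of composable bordisms up to gluing and deletion of thin identities. -/
instance : Category (Bdp n) where
  Hom X Y := (⟨X.as⟩ : CategoryTheory.Quotient (GluingRel n)) ⟶ ⟨Y.as⟩
  id X := 𝟙 (⟨X.as⟩ : CategoryTheory.Quotient (GluingRel n))
  comp {X Y Z} f g := CategoryStruct.comp (obj := CategoryTheory.Quotient (GluingRel n))
    (X := ⟨X.as⟩) (Y := ⟨Y.as⟩) (Z := ⟨Z.as⟩) f g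
  id_comp f := Category.id_comp (obj := CategoryTheory.Quotient (GluingRel n)) f
  comp_id f := Category.comp_id (obj := CategoryTheory.Quotient (GluingRel n)) f
  assoc f g h := Category.assoc (obj := CategoryTheory.Quotient (GluingRel n)) f g h

/-- The morphism given by a bordism. -/
def mk {M L : PointedManifold n} (X : Bordism M L) : of M ⟶ of L :=
  (CategoryTheory.Quotient.functor (GluingRel n)).map ((Paths.of (PointedManifold n)).map (X : M ⟶ L))

theorem mk_comp_mk {M L K : PointedManifold n} {X : Bordism M L} {Y : Bordism L K}
    {Z : Bordism M K} (h : Nonempty (Bordism.Gluing X Y Z)) : mk X ≫ mk Y = mk Z :=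
  ((CategoryTheory.Quotient.functor (GluingRel n)).map_comp _ _).symm.trans
    (CategoryTheory.Quotient.sound _ (GluingRel.glue X Y Z h))

theorem mk_eq_id {M : PointedManifold n} {X : Bordism M M} (h : X.IsIdentity) : mk X = 𝟙 (of M) :=
  CategoryTheory.Quotient.sound _ (GluingRel.ident X h)

/-- Every morphism is a composite of bordisms. -/
theorem induction {P : ∀ {M L : PointedManifold n}, (of M ⟶ of L) → Prop}
    (id : ∀ M, P (𝟙 (of M)))
    (comp : ∀ {M L K : PointedManifold n} (f : of M ⟶ of L) (X : Bordism L K), P f → P (f ≫ mk X))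
    {M L : PointedManifold n} (f : of M ⟶ of L) : P f := by
  refine CategoryTheory.Quotient.induction (GluingRel n) (P := fun {a b} f => @P a.as b.as f) ?_ f
  intro x y f
  refine Paths.induction (P := fun {a b} f => @P a b ((CategoryTheory.Quotient.functor (GluingRel n)).map f))
    ?_ ?_ f
  · exact id _
  · intro u v w p q hp
    have := comp ((CategoryTheory.Quotient.functor (GluingRel n)).map p) q hp
    rw [Functor.map_comp]
    exact this

/-- A functor out of the bordism category is determined by a map on bordisms which respects
gluings and identities. -/
def lift {C : Type*} [Category C] (obj : PointedManifold n → C)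
    (map : ∀ {M L : PointedManifold n}, Bordism M L → (obj M ⟶ obj L))
    (hglue : ∀ {M L K : PointedManifold n} {X : Bordism M L} {Y : Bordism L K} {Z : Bordism M K},
      Nonempty (Bordism.Gluing X Y Z) → map X ≫ map Y = map Z)
    (hid : ∀ {M : PointedManifold n} {X : Bordism M M}, X.IsIdentity → map X = 𝟙 (obj M)) :
    Bdp n ⥤ C :=
  let F : CategoryTheory.Quotient (GluingRel n) ⥤ C :=
    CategoryTheory.Quotient.lift (GluingRel n) (Paths.lift { obj := obj, map := fun X => map X }) (by
      intro x y f g h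
      cases h with
      | glue X Y Z h =>
        rw [Functor.map_comp]
        erw [Paths.lift_toPath, Paths.lift_toPath, Paths.lift_toPath]
        exact hglue h
      | ident X h =>
        rw [CategoryTheory.Functor.map_id]
        erw [Paths.lift_toPath]
        exact hid h)
  { obj := fun X => obj X.as
    map := fun {X Y} f => F.map (X := ⟨X.as⟩) (Y := ⟨Y.as⟩) f
    map_id := fun X => F.map_id ⟨X.as⟩
    map_comp := fun {X Y Z} f g => F.map_comp (X := ⟨X.as⟩) (Y := ⟨Y.as⟩) (Z := ⟨Z.as⟩) f g }

end Bdp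

namespace PointedManifold.Iso

variable {n : ℕ} {M N : PointedManifold n}

theorem ext {f g : Iso M N} (h : ∀ x, f x = g x) : f = g := by
  obtain ⟨f, _⟩ := f
  obtain ⟨g, _⟩ := g
  congr
  exact Diffeomorph.ext h

end PointedManifold.Iso

namespace Bdp

open Bordism PointedManifold

variable {n : ℕ} {M L K M' L' K' : PointedManifold n}

theorem thin_comp_mk (f : M.Iso M') (Y : Bordism M' L') :
    mk (thin f) ≫ mk Y = mk (precomp f Y) := mk_comp_mk (gluing_thin_left f Y)

theorem mk_comp_thin {X : Bordism M L} {Y : Bordism M' L'} {f : M.Iso M'} {g : L.Iso L'}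
    (φ : DiffeoOver X Y f g) : mk X ≫ mk (thin g) = mk (thin f) ≫ mk Y :=
  (mk_comp_mk φ.gluing).trans (thin_comp_mk f Y).symm

theorem thin_symm (f : M.Iso L) : mk (thin f) ≫ mk (thin f.symm) = 𝟙 (of M) := by
  rw [thin_comp_mk]
  exact mk_eq_id ⟨(isIdentity_thin_refl L).1, fun _ => rfl⟩

theorem mk_eq_thin {X : Bordism M L} (f : M.Iso L) (hX : IsEmpty X.thick.carrier)
    (h : ∀ m, X.inn m = X.out (f m)) : mk X = mk (thin f) := by
  have h1 : mk (thin f.symm) ≫ mk X = 𝟙 _ := by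
    rw [thin_comp_mk]
    refine mk_eq_id ⟨hX, fun l => ?_⟩
    exact (h (f.symm l)).trans (congrArg X.out (f.apply_symm_apply l))
  rw [← Category.id_comp (mk X), ← thin_symm f, Category.assoc, h1, Category.comp_id]

theorem thin_refl (M : PointedManifold n) : mk (thin (.refl M)) = 𝟙 (of M) :=
  mk_eq_id (isIdentity_thin_refl M)

theorem thin_trans (f : M.Iso L) (g : L.Iso K) :
    mk (thin f) ≫ mk (thin g) = mk (thin (f.trans g)) := by
  rw [thin_comp_mk]
  refine mk_eq_thin _ (isIdentity_thin_refl L).1 fun m => ?_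
  exact congrArg Sum.inr (g.symm_apply_apply (f m)).symm

theorem thin_sum (f : M.Iso L) (g : M'.Iso L') :
    mk ((thin f).sum (thin g)) = mk (thin (f.sumCongr g)) := by
  refine mk_eq_thin _ (((isIdentity_thin_refl M).sum (isIdentity_thin_refl M')).1) ?_
  rintro (m | m)
  · refine (sum_inn_inl _ _ _).trans (Eq.trans ?_ (sum_out_inl _ _ _).symm)
    exact congrArg _ (congrArg Sum.inr (f.symm_apply_apply m).symm)
  · refine (sum_inn_inr _ _ _).trans (Eq.trans ?_ (sum_out_inr _ _ _).symm)
    exact congrArg _ (congrArg Sum.inr (g.symm_apply_apply m).symm)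

/-- The isomorphism given by a diffeomorphism. -/
def thinIso (f : M.Iso L) : of M ≅ of L where
  hom := mk (thin f)
  inv := mk (thin f.symm)
  hom_inv_id := thin_symm f
  inv_hom_id := by
    rw [thin_trans, show f.symm.trans f = .refl L from Iso.ext f.apply_symm_apply, thin_refl]

theorem gluing_id_left (X : Bordism M L) : Nonempty (Gluing (thin (.refl M)) X X) :=
  gluing_thin_left (.refl M) X

theorem gluing_id_right (X : Bordism M L) : Nonempty (Gluing X (thin (.refl L)) X) :=
  DiffeoOver.gluing (f := .refl M) (g := .refl L) (Y := X)
    ⟨Diffeomorph.refl _ _ _, Equiv.refl _, fun m => by simp, fun m => by simp, fun m => by simp⟩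

theorem gluing_sum {X : Bordism M L} {Y : Bordism L K} {Z : Bordism M K} {X' : Bordism M' L'}
    {Y' : Bordism L' K'} {Z' : Bordism M' K'} (g : Nonempty (Gluing X Y Z))
    (g' : Nonempty (Gluing X' Y' Z')) :
    Nonempty (Gluing (X.sum X') (Y.sum Y') (Z.sum Z')) :=
  g.elim fun g => g'.elim fun g' => g.sum g'

/-- Disjoint union with a fixed manifold on the right. -/
def whiskerR (K : PointedManifold n) : Bdp n ⥤ Bdp n :=
  lift (fun M => of (M.sum K)) (fun X => mk (X.sum (thin (.refl K))))
    (fun h => mk_comp_mk (gluing_sum h (gluing_id_left _)))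
    (fun h => mk_eq_id (h.sum (isIdentity_thin_refl K)))

/-- Disjoint union with a fixed manifold on the left. -/
def whiskerL (K : PointedManifold n) : Bdp n ⥤ Bdp n :=
  lift (fun M => of (K.sum M)) (fun X => mk ((thin (.refl K)).sum X))
    (fun h => mk_comp_mk (gluing_sum (gluing_id_left _) h))
    (fun h => mk_eq_id ((isIdentity_thin_refl K).sum h))

instance : MonoidalCategoryStruct (Bdp n) where
  tensorObj X Y := of (X.as.sum Y.as)
  whiskerLeft X _ _ f := (whiskerL X.as).map f
  whiskerRight f Y := (whiskerR Y.as).map f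
  tensorUnit := of (.empty n)
  associator X Y Z := thinIso (Iso.sumAssoc X.as Y.as Z.as)
  leftUnitor X := thinIso (Iso.emptySum X.as)
  rightUnitor X := thinIso (Iso.sumEmpty X.as)

open MonoidalCategory

theorem whiskerRight_mk (X : Bordism M L) (K : PointedManifold n) :
    mk X ▷ of K = mk (X.sum (thin (.refl K))) :=
  Paths.lift_toPath _ _

theorem whiskerLeft_mk (X : Bordism M L) (K : PointedManifold n) :
    of K ◁ mk X = mk ((thin (.refl K)).sum X) :=
  Paths.lift_toPath _ _

theorem comp_whisker {X Y Z : Bdp n} (f : X ⟶ Y) (g : Y ⟶ Z) (K : Bdp n) :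
    (f ≫ g) ▷ K = f ▷ K ≫ g ▷ K := (whiskerR K.as).map_comp f g

theorem whisker_comp {X Y Z : Bdp n} (f : X ⟶ Y) (g : Y ⟶ Z) (K : Bdp n) :
    K ◁ (f ≫ g) = K ◁ f ≫ K ◁ g := (whiskerL K.as).map_comp f g

theorem id_whisker (X K : Bdp n) : 𝟙 X ▷ K = 𝟙 (X ⊗ K) := (whiskerR K.as).map_id X

theorem whisker_id (X K : Bdp n) : K ◁ 𝟙 X = 𝟙 (K ⊗ X) := (whiskerL K.as).map_id X

theorem whisker_exchange_mk (X : Bordism M L) (Y : Bordism M' L') :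
    mk X ▷ of M' ≫ of L ◁ mk Y = mk (X.sum Y) := by
  rw [whiskerRight_mk, whiskerLeft_mk]
  exact mk_comp_mk (gluing_sum (gluing_id_right X) (gluing_id_left Y))

theorem whisker_exchange_mk' (X : Bordism M L) (Y : Bordism M' L') :
    of M ◁ mk Y ≫ mk X ▷ of L' = mk (X.sum Y) := by
  rw [whiskerRight_mk, whiskerLeft_mk]
  exact mk_comp_mk (gluing_sum (gluing_id_left X) (gluing_id_right Y))

theorem exchange (f : of M ⟶ of L) (g : of M' ⟶ of L') :
    f ▷ of M' ≫ of L ◁ g = of M ◁ g ≫ f ▷ of L' := by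
  induction f using Bdp.induction with
  | id M =>
    rw [id_whisker, id_whisker, Category.id_comp, Category.comp_id]
  | comp f X hf =>
    rw [comp_whisker, comp_whisker, Category.assoc, ← reassoc_of% hf]
    congr 1
    clear hf
    induction g using Bdp.induction with
    | id M =>
      rw [whisker_id, whisker_id, Category.id_comp, Category.comp_id]
    | comp g Y hg =>
      rw [whisker_comp, whisker_comp, reassoc_of% hg, Category.assoc, whisker_exchange_mk,
        whisker_exchange_mk']

variable (M L K) in
/-- The thick part of a thin bordism is empty. -/
theorem isEmpty_thin (f : M.Iso L) : IsEmpty (thin f).thick.carrier := (isIdentity_thin_refl M).1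

section Nested

variable {A A' B B' C C' : PointedManifold n} (X : Bordism A A') (Y : Bordism B B')
  (Z : Bordism C C')

theorem sum_inn_ll (m : A.carrier) : ((X.sum Y).sum Z).inn (Sum.inl (Sum.inl m)) =
    (X.sum Y).sumInl Z (X.sumInl Y (X.inn m)) :=
  (sum_inn_inl (X.sum Y) Z (Sum.inl m)).trans (congrArg ((X.sum Y).sumInl Z) (sum_inn_inl X Y m))

theorem sum_inn_lr (m : B.carrier) : ((X.sum Y).sum Z).inn (Sum.inl (Sum.inr m)) =
    (X.sum Y).sumInl Z (X.sumInr Y (Y.inn m)) :=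
  (sum_inn_inl (X.sum Y) Z (Sum.inr m)).trans (congrArg ((X.sum Y).sumInl Z) (sum_inn_inr X Y m))

theorem sum_inn_rl (m : B.carrier) : (X.sum (Y.sum Z)).inn (Sum.inr (Sum.inl m)) =
    X.sumInr (Y.sum Z) (Y.sumInl Z (Y.inn m)) :=
  (sum_inn_inr X (Y.sum Z) (Sum.inl m)).trans (congrArg (X.sumInr (Y.sum Z)) (sum_inn_inl Y Z m))

theorem sum_inn_rr (m : C.carrier) : (X.sum (Y.sum Z)).inn (Sum.inr (Sum.inr m)) =
    X.sumInr (Y.sum Z) (Y.sumInr Z (Z.inn m)) :=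
  (sum_inn_inr X (Y.sum Z) (Sum.inr m)).trans (congrArg (X.sumInr (Y.sum Z)) (sum_inn_inr Y Z m))

theorem sum_out_ll (m : A'.carrier) : ((X.sum Y).sum Z).out (Sum.inl (Sum.inl m)) =
    (X.sum Y).sumInl Z (X.sumInl Y (X.out m)) :=
  (sum_out_inl (X.sum Y) Z (Sum.inl m)).trans (congrArg ((X.sum Y).sumInl Z) (sum_out_inl X Y m))

theorem sum_out_lr (m : B'.carrier) : ((X.sum Y).sum Z).out (Sum.inl (Sum.inr m)) =
    (X.sum Y).sumInl Z (X.sumInr Y (Y.out m)) :=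
  (sum_out_inl (X.sum Y) Z (Sum.inr m)).trans (congrArg ((X.sum Y).sumInl Z) (sum_out_inr X Y m))

theorem sum_out_rl (m : B'.carrier) : (X.sum (Y.sum Z)).out (Sum.inr (Sum.inl m)) =
    X.sumInr (Y.sum Z) (Y.sumInl Z (Y.out m)) :=
  (sum_out_inr X (Y.sum Z) (Sum.inl m)).trans (congrArg (X.sumInr (Y.sum Z)) (sum_out_inl Y Z m))

theorem sum_out_rr (m : C'.carrier) : (X.sum (Y.sum Z)).out (Sum.inr (Sum.inr m)) =
    X.sumInr (Y.sum Z) (Y.sumInr Z (Z.out m)) :=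
  (sum_out_inr X (Y.sum Z) (Sum.inr m)).trans (congrArg (X.sumInr (Y.sum Z)) (sum_out_inr Y Z m))

end Nested

section Naturality

local instance (f : M.Iso L) : IsEmpty (thin f).thick.carrier := isEmpty_thin M L f

theorem associator_nat_left_mk (X : Bordism M M') (L K : PointedManifold n) :
    mk ((X.sum (thin (.refl L))).sum (thin (.refl K))) ≫ mk (thin (Iso.sumAssoc M' L K)) =
      mk (thin (Iso.sumAssoc M L K)) ≫ mk (X.sum (thin (.refl (L.sum K)))) := by
  refine mk_comp_thin ⟨((Diffeomorph.sumEmpty _ _ _).trans (Diffeomorph.sumEmpty _ _ _)).trans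
    (Diffeomorph.sumEmpty _ _ _).symm, Equiv.sumAssoc X.N.carrier L.carrier K.carrier, ?_, ?_, ?_⟩
  · rintro ((m | l) | k)
    · refine (sum_inn_inl X (thin (.refl (L.sum K))) m).trans (Eq.trans ?_
        (congrArg (Sum.map _ _) (sum_inn_ll X (thin (.refl L)) (thin (.refl K)) m).symm))
      rcases X.inn m with t | t <;> rfl
    · rfl
    · rfl
  · rintro ((m | l) | k)
    · refine (sum_out_inl X (thin (.refl (L.sum K))) m).trans (Eq.trans ?_
        (congrArg (Sum.map _ _) (sum_out_ll X (thin (.refl L)) (thin (.refl K)) m).symm))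
      rcases X.out m with t | t <;> rfl
    · rfl
    · rfl
  · rintro (((w | w) | w) | ((x | l) | k))
    · rfl
    · exact (isEmpty_thin L L _).elim w
    · exact (isEmpty_thin K K _).elim w
    · rfl
    · rfl
    · rfl

theorem associator_nat_mid_mk (X : Bordism M M') (L K : PointedManifold n) :
    mk (((thin (.refl L)).sum X).sum (thin (.refl K))) ≫ mk (thin (Iso.sumAssoc L M' K)) =
      mk (thin (Iso.sumAssoc L M K)) ≫ mk ((thin (.refl L)).sum (X.sum (thin (.refl K)))) := by
  refine mk_comp_thin ⟨Diffeomorph.sumAssoc _ _ _ _ _,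
    Equiv.sumAssoc L.carrier X.N.carrier K.carrier, ?_, ?_, ?_⟩
  · rintro ((l | m) | k)
    · rfl
    · refine (sum_inn_rl (thin (.refl L)) X (thin (.refl K)) m).trans (Eq.trans ?_
        (congrArg (Sum.map _ _) (sum_inn_lr (thin (.refl L)) X (thin (.refl K)) m).symm))
      rcases X.inn m with t | t <;> rfl
    · rfl
  · rintro ((l | m) | k)
    · rfl
    · refine (sum_out_rl (thin (.refl L)) X (thin (.refl K)) m).trans (Eq.trans ?_
        (congrArg (Sum.map _ _) (sum_out_lr (thin (.refl L)) X (thin (.refl K)) m).symm))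
      rcases X.out m with t | t <;> rfl
    · rfl
  · rintro (((w | w) | w) | ((x | l) | k)) <;> rfl

theorem associator_nat_right_mk (X : Bordism M M') (L K : PointedManifold n) :
    mk ((thin (.refl (L.sum K))).sum X) ≫ mk (thin (Iso.sumAssoc L K M')) =
      mk (thin (Iso.sumAssoc L K M)) ≫ mk ((thin (.refl L)).sum ((thin (.refl K)).sum X)) := by
  refine mk_comp_thin ⟨(((Diffeomorph.sumComm _ _ _ _).trans (Diffeomorph.sumEmpty _ _ _)).trans
    ((Diffeomorph.sumEmpty _ _ _).symm.trans (Diffeomorph.sumComm _ _ _ _))).trans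
    ((Diffeomorph.sumEmpty _ _ _).symm.trans (Diffeomorph.sumComm _ _ _ _)),
    Equiv.sumAssoc L.carrier K.carrier X.N.carrier, ?_, ?_, ?_⟩
  · rintro ((l | k) | m)
    · rfl
    · rfl
    · refine (sum_inn_rr (thin (.refl L)) (thin (.refl K)) X m).trans (Eq.trans ?_
        (congrArg (Sum.map _ _) (sum_inn_inr (thin (.refl (L.sum K))) X m).symm))
      rcases X.inn m with t | t <;> rfl
  · rintro ((l | k) | m)
    · rfl
    · rfl
    · refine (sum_out_rr (thin (.refl L)) (thin (.refl K)) X m).trans (Eq.trans ?_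
        (congrArg (Sum.map _ _) (sum_out_inr (thin (.refl (L.sum K))) X m).symm))
      rcases X.out m with t | t <;> rfl
  · rintro ((w | w) | ((x | l) | k))
    · exact (isEmpty_thin (L.sum K) (L.sum K) _).elim w
    · rfl
    · rfl
    · rfl
    · rfl

theorem leftUnitor_nat_mk (X : Bordism M M') :
    mk ((thin (.refl (.empty n))).sum X) ≫ mk (thin (Iso.emptySum M')) =
      mk (thin (Iso.emptySum M)) ≫ mk X := by
  refine mk_comp_thin ⟨(Diffeomorph.sumComm _ _ _ _).trans (Diffeomorph.sumEmpty _ _ _),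
    Equiv.emptySum (PointedManifold.empty n).carrier X.N.carrier, ?_, ?_, ?_⟩
  · rintro (l | m)
    · exact isEmptyElim l
    · change X.inn m = _
      rw [sum_inn_inr]
      rcases X.inn m with t | t <;> rfl
  · rintro (l | m)
    · exact isEmptyElim l
    · change X.out m = _
      rw [sum_out_inr]
      rcases X.out m with t | t <;> rfl
  · rintro ((w | w) | (x | x))
    · exact (isEmpty_thin _ _ _).elim w
    · rfl
    · exact isEmptyElim (α := (PointedManifold.empty n).carrier) x
    · rfl

theorem rightUnitor_nat_mk (X : Bordism M M') :
    mk (X.sum (thin (.refl (.empty n)))) ≫ mk (thin (Iso.sumEmpty M')) =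
      mk (thin (Iso.sumEmpty M)) ≫ mk X := by
  refine mk_comp_thin ⟨Diffeomorph.sumEmpty _ _ _,
    Equiv.sumEmpty X.N.carrier (PointedManifold.empty n).carrier, ?_, ?_, ?_⟩
  · rintro (m | l)
    · change X.inn m = _
      rw [sum_inn_inl]
      rcases X.inn m with t | t <;> rfl
    · exact isEmptyElim l
  · rintro (m | l)
    · change X.out m = _
      rw [sum_out_inl]
      rcases X.out m with t | t <;> rfl
    · exact isEmptyElim l
  · rintro ((w | w) | (x | x))
    · rfl
    · exact (isEmpty_thin _ _ _).elim w
    · rfl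
    · exact isEmptyElim (α := (PointedManifold.empty n).carrier) x

theorem braiding_nat_mk (X : Bordism M M') (K : PointedManifold n) :
    mk (X.sum (thin (.refl K))) ≫ mk (thin (Iso.sumComm M' K)) =
      mk (thin (Iso.sumComm M K)) ≫ mk ((thin (.refl K)).sum X) := by
  refine mk_comp_thin ⟨Diffeomorph.sumComm _ _ _ _, Equiv.sumComm X.N.carrier K.carrier, ?_, ?_, ?_⟩
  · rintro (m | k)
    · change (Bordism.sum _ X).inn (Sum.inr m) = _
      rw [sum_inn_inl, sum_inn_inr]
      rcases X.inn m with t | t <;> rfl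
    · rfl
  · rintro (m | k)
    · change (Bordism.sum _ X).out (Sum.inr m) = _
      rw [sum_out_inl, sum_out_inr]
      rcases X.out m with t | t <;> rfl
    · rfl
  · rintro ((w | w) | (x | x)) <;> rfl

end Naturality

/-- Naturality may be checked on single bordisms. -/
theorem naturality_of_mk (F G : Bdp n ⥤ Bdp n) (τ : ∀ M : PointedManifold n, F.obj (of M) ⟶ G.obj (of M))
    (h : ∀ {M L : PointedManifold n} (X : Bordism M L), F.map (mk X) ≫ τ L = τ M ≫ G.map (mk X))
    {M L : PointedManifold n} (f : of M ⟶ of L) : F.map f ≫ τ L = τ M ≫ G.map f := by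
  induction f using Bdp.induction with
  | id M => rw [F.map_id, G.map_id, Category.id_comp, Category.comp_id]
  | comp f X hf => rw [F.map_comp, G.map_comp, Category.assoc, h, reassoc_of% hf]

theorem thinIso_hom (f : M.Iso L) : (thinIso f).hom = mk (thin f) := rfl

theorem whiskerRight_thin (f : M.Iso L) (K : PointedManifold n) :
    mk (thin f) ▷ of K = mk (thin (f.sumCongr (.refl K))) := by
  rw [whiskerRight_mk, thin_sum]

theorem whiskerLeft_thin (f : M.Iso L) (K : PointedManifold n) :
    of K ◁ mk (thin f) = mk (thin (.sumCongr (.refl K) f)) := by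
  rw [whiskerLeft_mk, thin_sum]

theorem associator_nat_left {X Y : Bdp n} (f : X ⟶ Y) (L K : Bdp n) :
    (f ▷ L) ▷ K ≫ (α_ Y L K).hom = (α_ X L K).hom ≫ f ▷ (L ⊗ K) := by
  refine naturality_of_mk (whiskerR L.as ⋙ whiskerR K.as) (whiskerR (L.as.sum K.as))
    (fun M => (α_ (of M) L K).hom) (fun {M M'} X => ?_) f
  have h := associator_nat_left_mk X L.as K.as
  rw [← whiskerRight_mk, ← whiskerRight_mk, ← whiskerRight_mk] at h
  exact h

theorem associator_nat_mid {X Y : Bdp n} (f : X ⟶ Y) (L K : Bdp n) :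
    (L ◁ f) ▷ K ≫ (α_ L Y K).hom = (α_ L X K).hom ≫ L ◁ (f ▷ K) := by
  refine naturality_of_mk (whiskerL L.as ⋙ whiskerR K.as) (whiskerR K.as ⋙ whiskerL L.as)
    (fun M => (α_ L (of M) K).hom) (fun {M M'} X => ?_) f
  have h := associator_nat_mid_mk X L.as K.as
  rw [← whiskerRight_mk, ← whiskerLeft_mk, ← whiskerLeft_mk, ← whiskerRight_mk] at h
  exact h

theorem associator_nat_right {X Y : Bdp n} (f : X ⟶ Y) (L K : Bdp n) :
    (L ⊗ K) ◁ f ≫ (α_ L K Y).hom = (α_ L K X).hom ≫ L ◁ (K ◁ f) := by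
  refine naturality_of_mk (whiskerL (L.as.sum K.as)) (whiskerL K.as ⋙ whiskerL L.as)
    (fun M => (α_ L K (of M)).hom) (fun {M M'} X => ?_) f
  have h := associator_nat_right_mk X L.as K.as
  rw [← whiskerLeft_mk, ← whiskerLeft_mk, ← whiskerLeft_mk] at h
  exact h

theorem braiding_nat {X Y : Bdp n} (f : X ⟶ Y) (K : Bdp n) :
    f ▷ K ≫ (thinIso (Iso.sumComm Y.as K.as)).hom =
      (thinIso (Iso.sumComm X.as K.as)).hom ≫ K ◁ f := by
  refine naturality_of_mk (whiskerR K.as) (whiskerL K.as)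
    (fun M => (thinIso (Iso.sumComm M K.as)).hom) (fun {M M'} X => ?_) f
  have h := braiding_nat_mk X K.as
  rw [← whiskerLeft_mk, ← whiskerRight_mk] at h
  exact h

/-- The symmetric monoidal structure given by disjoint union. -/
instance : MonoidalCategory (Bdp n) where
  tensorHom_def _ _ := rfl
  id_tensorHom_id X Y := by
    change 𝟙 X ▷ Y ≫ X ◁ 𝟙 Y = _
    rw [id_whisker, whisker_id, Category.id_comp]
  tensorHom_comp_tensorHom {X₁ Y₁ Z₁ X₂ Y₂ Z₂} f₁ f₂ g₁ g₂ := by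
    change (f₁ ▷ X₂ ≫ Y₁ ◁ f₂) ≫ (g₁ ▷ Y₂ ≫ Z₁ ◁ g₂) = (f₁ ≫ g₁) ▷ X₂ ≫ Z₁ ◁ (f₂ ≫ g₂)
    have h := exchange (M := Y₁.as) (L := Z₁.as) (M' := X₂.as) (L' := Y₂.as) g₁ f₂
    rw [comp_whisker, whisker_comp, Category.assoc, Category.assoc]
    exact congrArg (f₁ ▷ X₂ ≫ ·) (by
      rw [← Category.assoc, ← Category.assoc]
      exact congrArg (· ≫ Z₁ ◁ g₂) h.symm)
  whiskerLeft_id X Y := whisker_id Y X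
  id_whiskerRight X Y := id_whisker X Y
  associator_naturality {X₁ X₂ X₃ Y₁ Y₂ Y₃} f₁ f₂ f₃ := by
    change ((f₁ ▷ X₂ ≫ Y₁ ◁ f₂) ▷ X₃ ≫ (Y₁ ⊗ Y₂) ◁ f₃) ≫ _ =
      _ ≫ (f₁ ▷ (X₂ ⊗ X₃) ≫ Y₁ ◁ (f₂ ▷ X₃ ≫ Y₂ ◁ f₃))
    rw [comp_whisker, whisker_comp, Category.assoc, Category.assoc, associator_nat_right,
      ← Category.assoc ((Y₁ ◁ f₂) ▷ X₃), associator_nat_mid, Category.assoc,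
      ← Category.assoc ((f₁ ▷ X₂) ▷ X₃), associator_nat_left, Category.assoc]
  leftUnitor_naturality {X Y} f := by
    refine naturality_of_mk (whiskerL (.empty n)) (𝟭 _)
      (fun M => (λ_ (of M)).hom) (fun {M M'} X => ?_) f
    have h := leftUnitor_nat_mk X
    rw [← whiskerLeft_mk] at h
    exact h
  rightUnitor_naturality {X Y} f := by
    refine naturality_of_mk (whiskerR (.empty n)) (𝟭 _)
      (fun M => (ρ_ (of M)).hom) (fun {M M'} X => ?_) f
    have h := rightUnitor_nat_mk X
    rw [← whiskerRight_mk] at h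
    exact h
  pentagon W X Y Z := by
    change mk (thin _) ▷ of Z.as ≫ mk (thin _) ≫ of W.as ◁ mk (thin _) = mk (thin _) ≫ mk (thin _)
    rw [whiskerRight_thin, whiskerLeft_thin, thin_trans, thin_trans, thin_trans]
    congr 2
    apply PointedManifold.Iso.ext
    rintro (((x | x) | x) | x) <;> rfl
  triangle X Y := by
    change mk (thin _) ≫ of X.as ◁ mk (thin _) = mk (thin _) ▷ of Y.as
    rw [whiskerRight_thin, whiskerLeft_thin, thin_trans]
    congr 2
    apply PointedManifold.Iso.ext
    rintro ((x | x) | x)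
    · rfl
    · exact isEmptyElim (α := (PointedManifold.empty n).carrier) x
    · rfl

instance : BraidedCategory (Bdp n) where
  braiding X Y := thinIso (Iso.sumComm X.as Y.as)
  braiding_naturality_left f Z := braiding_nat f Z
  braiding_naturality_right X Y Z f := by
    refine (cancel_mono (thinIso (Iso.sumComm Z.as X.as)).hom).1 ?_
    have h : ∀ Y : Bdp n, (thinIso (Iso.sumComm X.as Y.as)).hom ≫
        (thinIso (Iso.sumComm Y.as X.as)).hom = 𝟙 _ := fun Y => thin_symm _
    refine (Category.assoc _ _ _).trans ((congrArg _ (h Z)).trans ((Category.comp_id _).trans ?_))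
    refine Eq.trans ?_ (Category.assoc _ _ _).symm
    refine Eq.trans ?_ (congrArg _ (braiding_nat f X).symm)
    refine Eq.trans ?_ (Category.assoc _ _ _)
    exact (Category.id_comp _).symm.trans (congrArg (· ≫ X ◁ f) (h Y).symm)
  hexagon_forward X Y Z := by
    change mk (thin _) ≫ mk (thin _) ≫ mk (thin _) =
      mk (thin _) ▷ of Z.as ≫ mk (thin _) ≫ of Y.as ◁ mk (thin _)
    rw [whiskerRight_thin, whiskerLeft_thin, thin_trans, thin_trans, thin_trans, thin_trans]
    congr 2
    apply PointedManifold.Iso.ext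
    rintro ((x | x) | x) <;> rfl
  hexagon_reverse X Y Z := by
    change mk (thin _) ≫ mk (thin _) ≫ mk (thin _) =
      of X.as ◁ mk (thin _) ≫ mk (thin _) ≫ mk (thin _) ▷ of Y.as
    rw [whiskerRight_thin, whiskerLeft_thin, thin_trans, thin_trans, thin_trans, thin_trans]
    congr 2
    apply PointedManifold.Iso.ext
    rintro (x | (x | x)) <;> rfl

instance : SymmetricCategory (Bdp n) where
  symmetry _ _ := thin_symm _

end Bdp


/-! ## The twisting bordism, traces and closed bordisms -/

/-- `t` is a trace of the endomorphism `f`: `f` is the image of a tensor `∑ φᵢ ⊗ vᵢ`, i.e.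
`f v = ∑ φᵢ v • vᵢ`, and `t = ∑ φᵢ vᵢ`. -/
def HasTrace {R V : Type*} [CommRing R] [AddCommGroup V] [Module R V] (f : V →ₗ[R] V) (t : R) :
    Prop :=
  ∃ τ : TensorProduct R (Module.Dual R V) V,
    dualTensorHom R V V τ = f ∧ contractLeft R V τ = t

namespace Bdp

open MonoidalCategory

variable {n : ℕ}

/-- The twisting bordism `M × [0, 1]` with one basepoint on each of the two ends. -/
def twist (M : PointedManifold n) : of M ⟶ of M :=
  mk (Bordism.ofThick (ThickBordism.cylinder M))

/-- A closed manifold with basepoints as an endomorphism of the unit object. -/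
def closed (W : ThickBordism (.empty n) (.empty n)) : 𝟙_ (Bdp n) ⟶ 𝟙_ (Bdp n) :=
  mk (Bordism.ofThick W)

/-- The map `R → R` which a TQFT assigns to an endomorphism of the unit object. -/
def value {R : Type u} [CommRing R] (Z : Bdp n ⥤ ModuleCat.{u} R) [Z.Monoidal]
    (f : 𝟙_ (Bdp n) ⟶ 𝟙_ (Bdp n)) : R →ₗ[R] R :=
  (Functor.LaxMonoidal.ε Z ≫ Z.map f ≫ Functor.OplaxMonoidal.η Z).hom

end Bdp

section Statement

open scoped Manifold ContDiff

/-- The closed bordism `W` is, up to diffeomorphism, `M × S¹` with the basepoints `x₁` and `x₂`. -/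
def ThickBordism.IsProdCircle {n : ℕ} (W : ThickBordism (.empty n) (.empty n)) (M : Type)
    [TopologicalSpace M] [ChartedSpace (EuclideanSpace ℝ (Fin n)) M] (x₁ x₂ : M × Circle) : Prop :=
  ∃ Φ : Diffeomorph ((𝓡 n).prod (𝓡 1)) (bordismModel n) (M × Circle) W.carrier ∞,
    W.basepoints = Φ '' {x₁, x₂}

/-- A TQFT with basepoints is split with factor `θ` if `Z(Θ_M²) = θ Z(Θ_M)` for every closed
connected orientable manifold `M` with one basepoint. -/
def Bdp.IsSplit {n : ℕ} {R : Type u} [CommRing R] (Z : Bdp n ⥤ ModuleCat.{u} R) (θ : R) : Prop :=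
  ∀ (M : Type) [TopologicalSpace M] [ChartedSpace (EuclideanSpace ℝ (Fin n)) M]
    [IsManifold (𝓡 n) ∞ M] [CompactSpace M] [T2Space M] [ConnectedSpace M]
    (hM : IsOrientable (𝓡 n) M) (p : M),
    Z.map (twist (.single M hM p) ≫ twist (.single M hM p)) = θ • Z.map (twist (.single M hM p))

end Statement

end

open scoped Manifold ContDiff

/-! ### Algebra of traces over a commutative ring -/

section Traces

open TensorProduct

variable {R V : Type*} [CommRing R] [AddCommGroup V] [Module R V]

/-! The cylinder on `M` can be bent. With both ends outgoing it is a copairing `d : 𝟙 → M ⊔ M`, with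
both ends incoming a pairing `c : M ⊔ M → 𝟙`. Without basepoints the snake composite of `d` and `c`
would be the identity and `Z(M)` would be dualizable. Here the basepoints on the gluing locus
survive, and the snake is `M × [0, 1]` with basepoints at the levels `0`, `1/2` and `1`, which is
`Θ²` (`Bdp.snake_eq_twist_comp_twist`).

Put `V = Z(M)`, write `Z(d)` as a finite sum `∑ aᵢ ⊗ bᵢ` and `c` also for the form on `V` induced by
the pairing. The snake identity reads `Z(Θ²) v = ∑ c(v ⊗ aᵢ) bᵢ`. This exhibits `Z(Θ²)` as a finite
sum of rank one maps, with trace `∑ c(bᵢ ⊗ aᵢ)`, the value of `c ∘ swap ∘ d` (`HasTrace.of_snake`,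
`hasTrace_map_snake`). On the geometric side `c ∘ swap ∘ d` closes two half cylinders up to `M × S¹`
with basepoints `(p, 1)` and `(p, -1)` (`Bdp.copairing_comp_pairing`). Diffeomorphisms of `M × S¹`
act transitively on ordered pairs of distinct points (`diffeoRel_prodCircle`), so every choice of
two basepoints gives the same value.

The rest is algebra. For `V` projective, `V* ⊗ V → End V` is injective, so a trace is unique; over a
domain one passes to the fraction field. If `g = Z(Θ)` satisfies `g² = θ g` with `θ ≠ 0`, then `θ⁻¹
g` is idempotent over the fraction field and its trace is its rank `m`, whence `g²` has trace `m θ²`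
(`HasTrace.exists_eq_natCast_mul_sq`). -/

theorem dualTensorHom_injective_of_projective [Module.Projective R V] :
    Function.Injective (dualTensorHom R V V) := by
  -- The section `s` of the free cover on the set `V` acts as a dual basis: `v = ∑ₑ (s v)(e) • e`.
  -- Hence `τ = ∑ₑ (s(·)(e) ∘ f) ⊗ e` with `f` the endomorphism induced by `τ`, so that `τ` is
  -- recovered from `f`.
  obtain ⟨s, hs⟩ := (Module.projective_def (R := R) (P := V)).1 inferInstance
  have key : ∀ τ : Module.Dual R V ⊗[R] V, dualTensorHom R V V τ = 0 → τ = 0 := by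
    intro τ hτ
    -- `s` expands the second factor in the generating family of all elements of `V`
    have h1 : ∀ τ : Module.Dual R V ⊗[R] V, ∃ A : Finset V,
        τ = ∑ e ∈ A, ((Finsupp.lapply e ∘ₗ s) ∘ₗ dualTensorHom R V V τ : Module.Dual R V) ⊗ₜ e := by
      intro τ
      classical
      have h2 : ∀ (A : Finset V) (φ : Module.Dual R V) (v : V), (s v).support ⊆ A →
          φ ⊗ₜ[R] v = ∑ e ∈ A, ((Finsupp.lapply e ∘ₗ s) ∘ₗ dualTensorHom R V V (φ ⊗ₜ v) :
            Module.Dual R V) ⊗ₜ[R] e := by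
        intro A φ v hA
        have h3 : v = ∑ e ∈ A, s v e • e := by
          conv_lhs => rw [← hs v, Finsupp.linearCombination_apply]
          exact Finsupp.sum_of_support_subset _ hA _ (by simp)
        conv_lhs => rw [h3, TensorProduct.tmul_sum]
        refine Finset.sum_congr rfl fun e _ => ?_
        rw [← TensorProduct.smul_tmul]
        congr 1
        ext w
        simp [dualTensorHom_apply, mul_comm]
      -- Asking for the expansion over every finite set containing `A₀` makes the claim additive:
      -- two tensors can be expanded over a common set.
      have h4 : ∃ A₀ : Finset V, ∀ A, A₀ ⊆ A →
          τ = ∑ e ∈ A, ((Finsupp.lapply e ∘ₗ s) ∘ₗ dualTensorHom R V V τ :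
            Module.Dual R V) ⊗ₜ[R] e := by
        induction τ using TensorProduct.induction_on with
        | zero => exact ⟨∅, fun A _ => by simp⟩
        | tmul φ v => exact ⟨(s v).support, fun A hA => h2 A φ v hA⟩
        | add x y hx hy =>
          obtain ⟨A, hA⟩ := hx
          obtain ⟨B, hB⟩ := hy
          refine ⟨A ∪ B, fun S hS => ?_⟩
          conv_lhs => rw [hA S (Finset.union_subset_left hS), hB S (Finset.union_subset_right hS)]
          simp only [map_add, LinearMap.comp_add, TensorProduct.add_tmul, Finset.sum_add_distrib]
      obtain ⟨A, hA⟩ := h4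
      exact ⟨A, hA A subset_rfl⟩
    obtain ⟨A, hA⟩ := h1 τ
    rw [hA, hτ]
    simp
  exact (injective_iff_map_eq_zero _).2 key

theorem HasTrace.unique_of_projective [Module.Projective R V] {f : V →ₗ[R] V} {s t : R}
    (hs : HasTrace f s) (ht : HasTrace f t) : s = t := by
  obtain ⟨σ, hσ, rfl⟩ := hs
  obtain ⟨τ, hτ, rfl⟩ := ht
  rw [dualTensorHom_injective_of_projective (hσ.trans hτ.symm)]

theorem HasTrace.eq_trace [Module.Free R V] [Module.Finite R V] {f : V →ₗ[R] V} {t : R}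
    (ht : HasTrace f t) : LinearMap.trace R V f = t := by
  obtain ⟨τ, rfl, rfl⟩ := ht
  exact LinearMap.trace_eq_contract_apply R V τ

theorem HasTrace.baseChange (S : Type*) [CommRing S] [Algebra R S] {f : V →ₗ[R] V} {t : R}
    (ht : HasTrace f t) : HasTrace (f.baseChange S) (algebraMap R S t) := by
  obtain ⟨τ, rfl, rfl⟩ := ht
  induction τ using TensorProduct.induction_on with
  | zero => exact ⟨0, by simp, by simp⟩
  | tmul φ v =>
    refine ⟨(Module.Dual.baseChange S φ) ⊗ₜ[S] (1 ⊗ₜ[R] v), ?_, ?_⟩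
    · ext w
      simp [dualTensorHom_apply]
    · simp [Algebra.algebraMap_eq_smul_one]
  | add x y hx hy =>
    obtain ⟨a, ha, ha'⟩ := hx
    obtain ⟨b, hb, hb'⟩ := hy
    exact ⟨a + b, by rw [map_add, map_add, ha, hb, LinearMap.baseChange_add],
      by rw [map_add, map_add, ha', hb', map_add]⟩

/-- A tensor representing `f` can be base changed, over the fraction field every module is
projective, and `R` embeds in its fraction field. -/
theorem HasTrace.unique_of_isDomain [IsDomain R] {f : V →ₗ[R] V} {s t : R}
    (hs : HasTrace f s) (ht : HasTrace f t) : s = t :=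
  FaithfulSMul.algebraMap_injective R (FractionRing R)
    ((hs.baseChange (FractionRing R)).unique_of_projective (ht.baseChange (FractionRing R)))

theorem HasTrace.smul {f : V →ₗ[R] V} {t : R} (ht : HasTrace f t) (c : R) :
    HasTrace (c • f) (c * t) := by
  obtain ⟨τ, rfl, rfl⟩ := ht
  exact ⟨c • τ, by simp, by simp⟩

/-- A map with a trace is a finite sum of maps of rank at most one. The space `W` itself may be
infinite-dimensional. -/
theorem HasTrace.finite_range {K W : Type*} [Field K] [AddCommGroup W] [Module K W]
    {f : W →ₗ[K] W} {t : K} (ht : HasTrace f t) : Module.Finite K (LinearMap.range f) := by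
  obtain ⟨τ, rfl, rfl⟩ := ht
  induction τ using TensorProduct.induction_on with
  | zero => rw [map_zero, LinearMap.range_zero]; infer_instance
  | tmul φ v =>
    have h : LinearMap.range (dualTensorHom K W W (φ ⊗ₜ v)) ≤ K ∙ v := by
      rintro _ ⟨w, rfl⟩
      rw [dualTensorHom_apply]
      exact Submodule.smul_mem _ _ (Submodule.mem_span_singleton_self v)
    exact Submodule.finiteDimensional_of_le h
  | add x y hx hy =>
    rw [map_add]
    exact Submodule.finiteDimensional_of_le (LinearMap.range_add_le _ _)

/-- The trace of an idempotent endomorphism of a vector space is its rank. -/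
theorem HasTrace.eq_finrank_of_isIdempotentElem {K W : Type*} [Field K] [AddCommGroup W]
    [Module K W] {e : W →ₗ[K] W} (he : ∀ w, e (e w) = e w) {t : K} (ht : HasTrace e t) :
    t = Module.finrank K (LinearMap.range e) := by
  have hfin := ht.finite_range
  let b := Module.finBasis K (LinearMap.range e)
  -- For a basis `bᵢ` of the range, `e = ∑ (bᵢ* ∘ e) ⊗ bᵢ`. Since `e` fixes its range, each term
  -- contracts to `1`, and the total is the size of the basis.
  refine ht.unique_of_projective ⟨∑ i, (b.coord i ∘ₗ e.rangeRestrict) ⊗ₜ[K] (b i : W), ?_, ?_⟩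
  · ext w
    have h := congrArg (LinearMap.range e).subtype (b.sum_repr (e.rangeRestrict w))
    rw [map_sum] at h
    rw [map_sum, LinearMap.sum_apply]
    exact h
  · have h : ∀ i, e.rangeRestrict (b i) = b i := by
      intro i
      apply Subtype.ext
      obtain ⟨w, hw⟩ := (b i).2
      change e (b i : W) = b i
      rw [← hw, he]
    simp [h]

/-- If `g² = θ g` over an integral domain then every trace of `g²` is a multiple of `θ²` by a
natural number. -/
theorem HasTrace.exists_eq_natCast_mul_sq [IsDomain R] {g : V →ₗ[R] V} {θ t : R}
    (hg : g ∘ₗ g = θ • g) (ht : HasTrace (g ∘ₗ g) t) : ∃ m : ℕ, t = m * θ ^ 2 := by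
  by_cases hθ : θ = 0
  -- If `θ = 0` then `g² = 0`, which also has the trace `0`.
  · refine ⟨0, ht.unique_of_isDomain ⟨0, ?_, ?_⟩⟩
    · rw [hg, hθ, zero_smul, map_zero]
    · simp
  let K := FractionRing R
  have hK : algebraMap R K θ ≠ 0 := by simpa using hθ
  let c : K := (algebraMap R K θ)⁻¹
  have h1 : (g ∘ₗ g).baseChange K = algebraMap R K θ • g.baseChange K := by
    rw [hg, LinearMap.baseChange_smul]
    ext w
    simp
  have h2 : ∀ w, g.baseChange K (g.baseChange K w) = algebraMap R K θ • g.baseChange K w := by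
    intro w
    rw [← LinearMap.smul_apply, ← h1, LinearMap.baseChange_comp, LinearMap.comp_apply]
  -- With `c = θ⁻¹`, the idempotent `c g` equals `c² g²`, so it has the trace `c² t`; this trace is
  -- the rank of `c g`.
  have h3 := (ht.baseChange K).smul (c ^ 2)
  rw [h1, smul_smul] at h3
  have hc : c ^ 2 * algebraMap R K θ = c := by
    rw [pow_two, mul_assoc, inv_mul_cancel₀ hK, mul_one]
  rw [hc] at h3
  have h4 := h3.eq_finrank_of_isIdempotentElem (fun w => by
    rw [LinearMap.smul_apply, LinearMap.smul_apply, map_smul, h2, smul_smul, smul_smul,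
      ← pow_two, hc])
  refine ⟨Module.finrank K (LinearMap.range (c • g.baseChange K)),
    FaithfulSMul.algebraMap_injective R K ?_⟩
  rw [map_mul, map_pow, map_natCast, ← h4, mul_right_comm, ← mul_pow, inv_mul_cancel₀ hK, one_pow,
    one_mul]

end Traces

/-! ### Traces from snake composites in monoidal categories -/

section Snake

open TensorProduct in
/-- An endomorphism which is obtained by the snake composite of a copairing `d` and a pairing `c` has
the trace `c ∘ swap ∘ d`. -/
theorem HasTrace.of_snake {R V : Type*} [CommRing R] [AddCommGroup V] [Module R V]
    (z : V ⊗[R] V) (c : V ⊗[R] V →ₗ[R] R) {f : V →ₗ[R] V}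
    (hf : ∀ v, f v = TensorProduct.lid R V (c.rTensor V
      ((TensorProduct.assoc R V V V).symm (v ⊗ₜ z)))) :
    HasTrace f (c (TensorProduct.comm R V V z)) := by
  -- `G` sends `a ⊗ b` to `c(· ⊗ a) ⊗ b`. On pure tensors the snake sends `v` to `c(v ⊗ a) b`, and
  -- the contraction is `c(b ⊗ a)`.
  let G : V ⊗[R] V →ₗ[R] Module.Dual R V ⊗[R] V :=
    (TensorProduct.curry (c ∘ₗ (TensorProduct.comm R V V).toLinearMap)).rTensor V
  refine ⟨G z, LinearMap.ext fun v => ?_, ?_⟩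
  · rw [hf]
    clear hf
    induction z using TensorProduct.induction_on with
    | zero => simp
    | tmul a b => simp [G, dualTensorHom_apply]
    | add x y hx hy => rw [map_add, map_add, LinearMap.add_apply, hx, hy, tmul_add, map_add,
        map_add, map_add]
  · clear hf
    induction z using TensorProduct.induction_on with
    | zero => simp
    | tmul a b => simp [G]
    | add x y hx hy => simp only [map_add, hx, hy]

open MonoidalCategory Functor.LaxMonoidal Functor.OplaxMonoidal

variable {C : Type*} [Category C] [MonoidalCategory C]

/-- A strong monoidal functor preserves the unitors and the associator up to `μ` and `δ`. These
cancel between consecutive factors, except for those absorbed into the images of `d` and `c`. -/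
theorem map_snake {D : Type*} [Category D] [MonoidalCategory D] (Z : C ⥤ D) [Z.Monoidal] {X : C}
    (d : 𝟙_ C ⟶ X ⊗ X) (c : X ⊗ X ⟶ 𝟙_ C) :
    Z.map ((ρ_ X).inv ≫ (X ◁ d) ≫ (α_ X X X).inv ≫ (c ▷ X) ≫ (λ_ X).hom) =
      (ρ_ (Z.obj X)).inv ≫ (Z.obj X ◁ (ε Z ≫ Z.map d ≫ δ Z X X)) ≫
        (α_ (Z.obj X) (Z.obj X) (Z.obj X)).inv ≫ ((μ Z X X ≫ Z.map c ≫ η Z) ▷ Z.obj X) ≫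
          (λ_ (Z.obj X)).hom := by
  simp only [Functor.map_comp, Functor.Monoidal.map_rightUnitor_inv,
    Functor.Monoidal.map_associator_inv, Functor.Monoidal.map_leftUnitor,
    Functor.Monoidal.map_whiskerLeft, Functor.Monoidal.map_whiskerRight, Category.assoc,
    MonoidalCategory.whiskerLeft_comp, comp_whiskerRight, Functor.Monoidal.μ_δ_assoc]

/-- Compatibility with the braiding is what turns `Z(β)` into the flip of `V ⊗ V`, so that the
scalar of `HasTrace.of_snake` becomes the value of an endomorphism of the unit object. -/
theorem hasTrace_map_snake [BraidedCategory C] {R : Type u} [CommRing R] (Z : C ⥤ ModuleCat.{u} R)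
    [Z.Braided] {X : C} (d : 𝟙_ C ⟶ X ⊗ X) (c : X ⊗ X ⟶ 𝟙_ C) :
    HasTrace (Z.map ((ρ_ X).inv ≫ (X ◁ d) ≫ (α_ X X X).inv ≫ (c ▷ X) ≫ (λ_ X).hom)).hom
      ((ε Z ≫ Z.map (d ≫ (β_ X X).hom ≫ c) ≫ η Z).hom (1 : R)) := by
  have h : ε Z ≫ Z.map (d ≫ (β_ X X).hom ≫ c) ≫ η Z =
      (ε Z ≫ Z.map d ≫ δ Z X X) ≫ (β_ (Z.obj X) (Z.obj X)).hom ≫ μ Z X X ≫ Z.map c ≫ η Z := by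
    rw [Functor.map_comp, Functor.map_comp, Functor.map_braiding]
    simp
  rw [h, map_snake]
  exact HasTrace.of_snake ((ε Z ≫ Z.map d ≫ δ Z X X).hom (1 : R)) (μ Z X X ≫ Z.map c ≫ η Z).hom
    fun v => rfl

end Snake

/-! ### Moving pairs of points by diffeomorphisms -/

section Homogeneity

open scoped Manifold ContDiff NNReal

/-- In a finite-dimensional space, a point can be moved by any small vector through a diffeomorphism
which is the identity off a given ball. -/
theorem exists_contDiff_equiv_translate {E : Type*} [NormedAddCommGroup E] [NormedSpace ℝ E]
    [FiniteDimensional ℝ E] (u₀ : E) {r : ℝ} (hr : 0 < r) :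
    ∃ δ > 0, ∀ v : E, ‖v‖ < δ → ∃ Ψ : E ≃ E, ContDiff ℝ ∞ Ψ ∧ ContDiff ℝ ∞ Ψ.symm ∧
      Ψ u₀ = u₀ + v ∧ ∀ u ∉ Metric.closedBall u₀ r, Ψ u = u := by
  have : CompleteSpace E := FiniteDimensional.complete ℝ E
  let b : ContDiffBump u₀ := ⟨r / 2, r, by positivity, by linarith⟩
  have hb : ContDiff ℝ ∞ b := b.contDiff
  obtain ⟨K, hK⟩ := b.contDiff.lipschitzWith_of_hasCompactSupport (n := ∞) (𝕂 := ℝ)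
    b.hasCompactSupport (by simp)
  -- `K` is a Lipschitz constant of the bump function `b`. The bound on `v` gives `K ‖v‖ < 1`,
  -- including the case `K = 0`, so that `u ↦ u + b(u) v` is a small perturbation of the identity.
  refine ⟨1 / (K + 1), by positivity, fun v hv => ?_⟩
  have hKv : K * ‖v‖ < 1 := by
    rw [lt_div_iff₀ (by positivity)] at hv
    nlinarith [norm_nonneg v]
  let ψ : E → E := fun u => u + b u • v
  have hψ : ContDiff ℝ ∞ ψ := contDiff_id.add (hb.smul contDiff_const)
  have happrox : ApproximatesLinearOn ψ ((ContinuousLinearEquiv.refl ℝ E : E ≃L[ℝ] E) : E →L[ℝ] E)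
      univ (K * ‖v‖₊) := by
    intro x _ y _
    have h1 : ψ x - ψ y - ((ContinuousLinearEquiv.refl ℝ E : E ≃L[ℝ] E) : E →L[ℝ] E) (x - y) =
        (b x - b y) • v := by
      simp only [ψ, ContinuousLinearEquiv.coe_refl, ContinuousLinearMap.coe_id', id, sub_smul]
      abel
    rw [h1, norm_smul]
    have h2 := hK.norm_sub_le x y
    calc ‖b x - b y‖ * ‖v‖ ≤ (K * ‖x - y‖) * ‖v‖ := by gcongr
      _ = _ := by push_cast; ring
  -- The zero space is separate because the identity has norm `1` only on a nontrivial space.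
  have hc : Subsingleton E ∨ K * ‖v‖₊ <
      ‖((ContinuousLinearEquiv.refl ℝ E).symm : E →L[ℝ] E)‖₊⁻¹ := by
    rcases subsingleton_or_nontrivial E with h | h
    · exact Or.inl h
    · right
      have h3 : ‖((ContinuousLinearEquiv.refl ℝ E).symm : E →L[ℝ] E)‖₊ = 1 := by
        simp
      rw [h3, inv_one, ← NNReal.coe_lt_coe]
      exact_mod_cast hKv
  let f : E ≃ₜ E := happrox.toHomeomorph ψ hc
  have hderiv : ∀ a, HasFDerivAt ψ
      (ContinuousLinearMap.id ℝ E + (fderiv ℝ b a).smulRight v) a := fun a =>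
    (hasFDerivAt_id a).add ((hb.differentiable (by simp) a).hasFDerivAt.smul_const v)
  -- If `w + db(w) v = 0` then `‖w‖ ≤ K ‖v‖ ‖w‖`, which forces `w = 0`. In finite dimension the
  -- derivative is then invertible, which makes the inverse homeomorphism smooth.
  have hinj : ∀ a, Function.Injective
      ((ContinuousLinearMap.id ℝ E + (fderiv ℝ b a).smulRight v : E →L[ℝ] E) : E →ₗ[ℝ] E) := by
    intro a
    rw [← LinearMap.ker_eq_bot, LinearMap.ker_eq_bot']
    intro w hw
    have hw' : w = -(fderiv ℝ b a w • v) := by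
      rw [eq_neg_iff_add_eq_zero]
      exact hw
    have h4 : ‖w‖ ≤ K * ‖v‖ * ‖w‖ := by
      calc ‖w‖ = ‖fderiv ℝ b a w‖ * ‖v‖ := by rw [← norm_smul, ← norm_neg (_ • v), ← hw']
        _ ≤ (K * ‖w‖) * ‖v‖ := by
          gcongr
          exact (ContinuousLinearMap.le_opNorm _ w).trans
            (by gcongr; exact norm_fderiv_le_of_lipschitz ℝ hK)
        _ = K * ‖v‖ * ‖w‖ := by ring
    by_contra hne
    have := norm_pos_iff.2 hne
    nlinarith
  have hsymm : ContDiff ℝ ∞ f.symm := by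
    refine f.contDiff_symm (f₀' := fun a =>
      (LinearEquiv.ofInjectiveEndo _ (hinj a)).toContinuousLinearEquiv) (fun a => ?_) hψ
    refine (hderiv a).congr_fderiv ?_
    ext w
    rfl
  refine ⟨f.toEquiv, hψ, hsymm, ?_, fun u hu => ?_⟩
  · change u₀ + b u₀ • v = _
    rw [b.one_of_mem_closedBall (by simp [b.rIn_pos.le]), one_smul]
  · change u + b u • v = u
    rw [b.zero_of_le_dist (by simpa using (not_le.1 hu).le), zero_smul, add_zero]

variable {E H N : Type*} [NormedAddCommGroup E] [NormedSpace ℝ E] [TopologicalSpace H]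
  {I : ModelWithCorners ℝ E H} [TopologicalSpace N] [ChartedSpace H N]

open Classical in
/-- The map of a manifold which is given in the chart at `x₀` by `Ψ`, and is the identity off the
domain of this chart. -/
noncomputable def chartExtend (I : ModelWithCorners ℝ E H) (x₀ : N) (Ψ : E → E) (x : N) : N :=
  if x ∈ (extChartAt I x₀).source then (extChartAt I x₀).symm (Ψ (extChartAt I x₀ x)) else x

theorem chartExtend_leftInverse (x₀ : N) {Ψ Ψ' : E → E} (h : Function.LeftInverse Ψ' Ψ)
    (hmaps : MapsTo Ψ (extChartAt I x₀).target (extChartAt I x₀).target) :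
    Function.LeftInverse (chartExtend I x₀ Ψ') (chartExtend I x₀ Ψ) := by
  intro x
  by_cases hx : x ∈ (extChartAt I x₀).source
  · have h1 := hmaps ((extChartAt I x₀).map_source hx)
    have h2 := (extChartAt I x₀).map_target h1
    rw [show chartExtend I x₀ Ψ x = _ from if_pos hx, chartExtend, if_pos h2,
      (extChartAt I x₀).right_inv h1, h, (extChartAt I x₀).left_inv hx]
  · rw [show chartExtend I x₀ Ψ x = _ from if_neg hx, chartExtend, if_neg hx]

/-- Smoothness on the chart domain is clear. The preimage of `K` in the manifold is compact, hence
closed because the manifold is Hausdorff; off it the map is the identity, and this open set contains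
all points outside the chart domain. -/
theorem contMDiff_chartExtend [IsManifold I ∞ N] [T2Space N] (x₀ : N) {Ψ : E → E} (hΨ : ContDiff ℝ ∞ Ψ)
    (hmaps : MapsTo Ψ (extChartAt I x₀).target (extChartAt I x₀).target) {K : Set E}
    (hK : IsCompact K) (hKt : K ⊆ (extChartAt I x₀).target) (hid : ∀ u ∉ K, Ψ u = u) :
    ContMDiff I I ∞ (chartExtend I x₀ Ψ : N → N) := by
  intro x
  by_cases hx : x ∈ (extChartAt I x₀).source
  · have h1 : ContMDiffOn I I ∞ (fun x => (extChartAt I x₀).symm (Ψ (extChartAt I x₀ x)))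
        (extChartAt I x₀).source := by
      refine (contMDiffOn_extChartAt_symm x₀).comp (hΨ.contMDiff.comp_contMDiffOn ?_)
        (fun y hy => hmaps ((extChartAt I x₀).map_source hy))
      rw [extChartAt_source]
      exact contMDiffOn_extChartAt
    have hn := extChartAt_source_mem_nhds' (I := I) hx
    refine (h1.contMDiffAt hn).congr_of_eventuallyEq ?_
    filter_upwards [hn] with y hy
    exact if_pos hy
  · have hA : IsClosed ((extChartAt I x₀).symm '' K) :=
      (hK.image_of_continuousOn ((continuousOn_extChartAt_symm x₀).mono hKt)).isClosed
    have hxA : x ∉ (extChartAt I x₀).symm '' K := by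
      rintro ⟨u, hu, rfl⟩
      exact hx ((extChartAt I x₀).map_target (hKt hu))
    refine contMDiffAt_id.congr_of_eventuallyEq ?_
    filter_upwards [hA.isOpen_compl.mem_nhds hxA] with y hy
    by_cases hys : y ∈ (extChartAt I x₀).source
    · have h2 : extChartAt I x₀ y ∉ K := fun h => hy ⟨_, h, (extChartAt I x₀).left_inv hys⟩
      rw [show chartExtend I x₀ Ψ y = _ from if_pos hys, hid _ h2, (extChartAt I x₀).left_inv hys]
      rfl
    · exact if_neg hys

variable (I) in
/-- A point of a manifold can be moved to any nearby point by a diffeomorphism which is the identity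
off a given neighbourhood. -/
theorem eventually_exists_diffeomorph [FiniteDimensional ℝ E] [I.Boundaryless]
    [IsManifold I ∞ N] [T2Space N] (x₀ : N) {U : Set N} (hU : U ∈ 𝓝 x₀) :
    ∀ᶠ y in 𝓝 x₀, ∃ Φ : Diffeomorph I I N N ∞, Φ x₀ = y ∧ ∀ z ∉ U, Φ z = z := by
  have h1 : (extChartAt I x₀).target ∩ (extChartAt I x₀).symm ⁻¹' U ∈ 𝓝 (extChartAt I x₀ x₀) := by
    refine Filter.inter_mem (extChartAt_target_mem_nhds x₀) ?_
    exact (continuousAt_extChartAt_symm x₀).preimage_mem_nhds (by rwa [extChartAt_to_inv])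
  obtain ⟨r, hr, hrs⟩ := Metric.nhds_basis_closedBall.mem_iff.1 h1
  obtain ⟨δ, hδ, hΨ⟩ := exists_contDiff_equiv_translate (extChartAt I x₀ x₀) hr
  have h2 : ∀ᶠ y in 𝓝 x₀, ‖extChartAt I x₀ y - extChartAt I x₀ x₀‖ < δ := by
    have := (continuousAt_extChartAt (I := I) x₀).eventually (Metric.ball_mem_nhds _ hδ)
    filter_upwards [this] with y hy
    rwa [← dist_eq_norm]
  filter_upwards [h2, extChartAt_source_mem_nhds (I := I) x₀] with y hy hys
  obtain ⟨Ψ, hs, hs', h0, hid⟩ := hΨ _ hy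
  have hKt : Metric.closedBall (extChartAt I x₀ x₀) r ⊆ (extChartAt I x₀).target :=
    fun u hu => (hrs hu).1
  have hid' : ∀ u ∉ Metric.closedBall (extChartAt I x₀ x₀) r, Ψ.symm u = u := fun u hu => by
    rw [Equiv.symm_apply_eq, hid u hu]
  have hmaps : ∀ Ψ : E ≃ E, (∀ u ∉ Metric.closedBall (extChartAt I x₀ x₀) r, Ψ u = u) →
      MapsTo Ψ (extChartAt I x₀).target (extChartAt I x₀).target := by
    intro Ψ h u hu
    -- If `Ψ u` lies outside the ball, then `Ψ` fixes it, so `Ψ (Ψ u) = Ψ u` and injectivity gives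
    -- `Ψ u = u`.
    by_cases h3 : Ψ u ∈ Metric.closedBall (extChartAt I x₀ x₀) r
    · exact hKt h3
    · rwa [Ψ.injective (h _ h3)]
  have hcpt := isCompact_closedBall (extChartAt I x₀ x₀) r
  refine ⟨⟨⟨chartExtend I x₀ Ψ, chartExtend I x₀ Ψ.symm,
    chartExtend_leftInverse x₀ Ψ.left_inv (hmaps Ψ hid),
    chartExtend_leftInverse x₀ Ψ.right_inv (hmaps Ψ.symm hid')⟩,
    contMDiff_chartExtend x₀ hs (hmaps Ψ hid) hcpt hKt hid,
    contMDiff_chartExtend x₀ hs' (hmaps Ψ.symm hid') hcpt hKt hid'⟩, ?_, fun z hz => ?_⟩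
  · change chartExtend I x₀ Ψ x₀ = y
    rw [chartExtend, if_pos (mem_extChartAt_source x₀), h0, add_sub_cancel,
      (extChartAt I x₀).left_inv hys]
  · change chartExtend I x₀ Ψ z = z
    by_cases hzs : z ∈ (extChartAt I x₀).source
    · have h3 : extChartAt I x₀ z ∉ Metric.closedBall (extChartAt I x₀ x₀) r := fun h => hz (by
        have := (hrs h).2
        rwa [mem_preimage, (extChartAt I x₀).left_inv hzs] at this)
      rw [chartExtend, if_pos hzs, hid _ h3, (extChartAt I x₀).left_inv hzs]
    · exact if_neg hzs

variable (I) in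
/-- Two pairs of points of a manifold are related if a diffeomorphism carries one to the other. -/
def DiffeoRel (x y x' y' : N) : Prop := ∃ Φ : Diffeomorph I I N N ∞, Φ x = x' ∧ Φ y = y'

namespace DiffeoRel

variable {x y x' y' x'' y'' : N}

theorem symm (h : DiffeoRel I x y x' y') : DiffeoRel I x' y' x y := by
  obtain ⟨Φ, rfl, rfl⟩ := h
  exact ⟨Φ.symm, Φ.symm_apply_apply _, Φ.symm_apply_apply _⟩

theorem trans (h : DiffeoRel I x y x' y') (h' : DiffeoRel I x' y' x'' y'') :
    DiffeoRel I x y x'' y'' := by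
  obtain ⟨Φ, rfl, rfl⟩ := h
  obtain ⟨Ψ, rfl, rfl⟩ := h'
  exact ⟨Φ.trans Ψ, rfl, rfl⟩

theorem swap (h : DiffeoRel I x y x' y') : DiffeoRel I y x y' x' :=
  let ⟨Φ, hx, hy⟩ := h
  ⟨Φ, hy, hx⟩

variable [FiniteDimensional ℝ E] [I.Boundaryless] [IsManifold I ∞ N] [T2Space N]

theorem eventually (hxy : x ≠ y) : ∀ᶠ z in 𝓝 x, DiffeoRel I x y z y := by
  filter_upwards [eventually_exists_diffeomorph I x (isOpen_compl_singleton.mem_nhds hxy)] with z hz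
  obtain ⟨Φ, h1, h2⟩ := hz
  exact ⟨Φ, h1, h2 y (by simp)⟩

/-- The first point can be moved along any connected family which avoids the second point. -/
theorem of_preconnected {X : Type*} [TopologicalSpace X] [PreconnectedSpace X] {f : X → N}
    (hf : Continuous f) (hy : ∀ a, f a ≠ y) (a b : X) : DiffeoRel I (f a) y (f b) y := by
  -- By `eventually`, being reachable by a diffeomorphism fixing `y` is a locally constant condition
  -- along the family.
  refine PreconnectedSpace.induction₂' (fun a b => DiffeoRel I (f a) y (f b) y) (fun a => ?_)
    ⟨fun _ _ _ => trans⟩ a b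
  filter_upwards [hf.continuousAt.eventually (eventually (I := I) (hy a))] with b hb
  exact ⟨hb, hb.symm⟩

end DiffeoRel

variable {M : Type*} [TopologicalSpace M] [ChartedSpace H M] [IsManifold I ∞ M]

/-- A diffeomorphism of `M × S¹` which rotates the circle. -/
noncomputable def Diffeomorph.prodCircleRotate (I : ModelWithCorners ℝ E H) (M : Type*)
    [TopologicalSpace M] [ChartedSpace H M] (c : Circle) :
    Diffeomorph (I.prod (𝓡 1)) (I.prod (𝓡 1)) (M × Circle) (M × Circle) ∞ :=
  (Diffeomorph.refl I M ∞).prodCongr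
    { toEquiv := Equiv.mulLeft c
      contMDiff_toFun := contMDiff_mul_left
      contMDiff_invFun := contMDiff_mul_left (a := c⁻¹) }

variable [FiniteDimensional ℝ E] [I.Boundaryless] [T2Space M] [PreconnectedSpace M]

theorem Circle.exp_pi_eq_neg_one : Circle.exp Real.pi = -1 := by
  ext
  simp

/-- Diffeomorphisms of `M × S¹` act transitively on the pairs of distinct points. -/
theorem diffeoRel_prodCircle (p : M) {x y : M × Circle} (hxy : x ≠ y) :
    DiffeoRel (I.prod (𝓡 1)) x y (p, 1) (p, -1) := by
  -- it is enough to treat points with different circle components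
  have key : ∀ (q q' : M) (s s' : Circle), s ≠ s' →
      DiffeoRel (I.prod (𝓡 1)) (q, s) (q', s') (p, 1) (p, -1) := by
    intro q q' s s' hs
    -- Each point moves inside its own slice `M × {s}`, a connected set that misses the other point.
    -- This argument needs no lower bound on the dimension of `M`.
    have h1 : DiffeoRel (I.prod (𝓡 1)) (q, s) (q', s') (p, s) (q', s') :=
      .of_preconnected (f := fun a : M => (a, s)) (by fun_prop)
        (fun a h => hs (congrArg Prod.snd h)) q p
    have h2 : DiffeoRel (I.prod (𝓡 1)) (p, s) (q', s') (p, s) (p, s') :=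
      (DiffeoRel.of_preconnected (f := fun a : M => (a, s')) (by fun_prop)
        (fun a h => hs (congrArg Prod.snd h).symm) q' p).swap
    have h3 : DiffeoRel (I.prod (𝓡 1)) (p, s) (p, s') (p, 1) (p, s⁻¹ * s') :=
      ⟨Diffeomorph.prodCircleRotate I M s⁻¹, Prod.ext rfl (inv_mul_cancel s), rfl⟩
    -- After a rotation the first point is `(p, 1)`. The second one then moves to `(p, -1)` along
    -- `{p} × (S¹ ∖ {1})`, parametrised by the angles in `(0, 2π)`.
    have h4 : ∀ r : Ioo (0 : ℝ) (2 * Real.pi), Circle.exp r ≠ 1 := by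
      rintro ⟨r, hr0, hr⟩ h
      obtain ⟨m, hm⟩ := Circle.exp_eq_one.1 h
      have hm0 : (0 : ℝ) < m := by
        by_contra hneg
        nlinarith [Real.pi_pos]
      have hm1 : (m : ℝ) < 1 := by
        by_contra hneg
        nlinarith [Real.pi_pos]
      have h5 : 0 < m := by exact_mod_cast hm0
      have h6 : m < 1 := by exact_mod_cast hm1
      omega
    have hconn : PreconnectedSpace (Ioo (0 : ℝ) (2 * Real.pi)) :=
      Subtype.preconnectedSpace isPreconnected_Ioo
    have h5 : ∃ r : Ioo (0 : ℝ) (2 * Real.pi), Circle.exp r = s⁻¹ * s' := by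
      obtain ⟨r, hr⟩ := Circle.exp_surjective (s⁻¹ * s')
      have hr' : Circle.exp (toIcoMod Real.two_pi_pos 0 r) = s⁻¹ * s' := by
        rw [← hr, Circle.exp_eq_exp]
        exact ⟨-toIcoDiv Real.two_pi_pos 0 r, by
          rw [toIcoMod, zsmul_eq_mul]; push_cast; ring⟩
      have hmem := toIcoMod_mem_Ico Real.two_pi_pos 0 r
      rw [zero_add] at hmem
      refine ⟨⟨_, lt_of_le_of_ne hmem.1 fun h0 => hs ?_, hmem.2⟩, hr'⟩
      rw [← h0, Circle.exp_zero] at hr'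
      exact (inv_mul_eq_one.1 hr'.symm)
    obtain ⟨r, hr⟩ := h5
    have h6 : DiffeoRel (I.prod (𝓡 1)) (p, 1) (p, s⁻¹ * s') (p, 1) (p, -1) := by
      have := (DiffeoRel.of_preconnected (I := I.prod (𝓡 1)) (y := (p, (1 : Circle)))
        (f := fun a : Ioo (0 : ℝ) (2 * Real.pi) => (p, Circle.exp a))
        (by fun_prop) (fun a h => h4 a (congrArg Prod.snd h)) r
        ⟨Real.pi, Real.pi_pos, by linarith [Real.pi_pos]⟩).swap
      simpa only [hr, Circle.exp_pi_eq_neg_one] using this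
    exact (h1.trans h2).trans (h3.trans h6)
  obtain ⟨q, s⟩ := x
  obtain ⟨q', s'⟩ := y
  by_cases hs : s = s'
  -- Two points over the same circle coordinate: the circle has no isolated points, so a small push
  -- of the first point separates the coordinates.
  · have hnt : Nontrivial Circle := ⟨1, -1, fun h => by
      have h' := congrArg (fun z : Circle => (z : ℂ)) h
      norm_num [Circle.coe_neg] at h'⟩
    have hne : (𝓝[≠] s).NeBot := inferInstance
    have h7 : ∀ᶠ t in 𝓝[≠] s, DiffeoRel (I.prod (𝓡 1)) (q, s) (q', s') (q, t) (q', s') :=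
      ((Continuous.prodMk_right q).continuousAt.eventually
        (DiffeoRel.eventually hxy)).filter_mono nhdsWithin_le_nhds
    obtain ⟨t, ht, hts⟩ := (h7.and self_mem_nhdsWithin).exists
    exact ht.trans (key q q' t s' (hs ▸ hts))
  · exact key q q' s s' hs

end Homogeneity

/-! ### Criteria for immersions -/

section Immersions

open scoped Manifold ContDiff

variable {E H E' H' E'' H'' : Type*} [NormedAddCommGroup E] [NormedSpace ℝ E] [TopologicalSpace H]
  [NormedAddCommGroup E'] [NormedSpace ℝ E'] [TopologicalSpace H']
  [NormedAddCommGroup E''] [NormedSpace ℝ E''] [TopologicalSpace H'']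
  {I : ModelWithCorners ℝ E H} {I' : ModelWithCorners ℝ E' H'} {I'' : ModelWithCorners ℝ E'' H''}
  {M M₁ N K : Type*} [TopologicalSpace M] [ChartedSpace H M] [TopologicalSpace M₁]
  [ChartedSpace H M₁] [TopologicalSpace N] [ChartedSpace H' N] [TopologicalSpace K]
  [ChartedSpace H'' K]

theorem IsSmoothImmersion.comp {g : N → K} {f : M → N} (hg : IsSmoothImmersion I' I'' g)
    (hf : IsSmoothImmersion I I' f) : IsSmoothImmersion I I'' (g ∘ f) := by
  refine ⟨hg.1.comp hf.1, fun x => ?_⟩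
  rw [mfderiv_comp x (hg.1.mdifferentiable (by simp) _) (hf.1.mdifferentiable (by simp) _)]
  exact (hg.2 _).comp (hf.2 x)

theorem IsSmoothImmersion.sumElim {f : M → N} {g : M₁ → N} (hf : IsSmoothImmersion I I' f)
    (hg : IsSmoothImmersion I I' g) : IsSmoothImmersion I I' (Sum.elim f g) := by
  have hs := ContMDiff.sumElim hf.1 hg.1
  have hd : MDifferentiable I I' (Sum.elim f g) := hs.mdifferentiable (by simp)
  refine ⟨hs, ?_⟩
  rintro (x | x)
  · have h1 := (hd (Sum.inl x)).hasMFDerivAt.comp x (hasMFDerivAt_inl (I := I) (M' := M₁) (q := x))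
    have h3 := hasMFDerivAt_unique h1 (hf.1.mdifferentiable (by simp) x).hasMFDerivAt
    intro v w hvw
    exact hf.2 x
      ((DFunLike.congr_fun h3 v).symm.trans (Eq.trans hvw (DFunLike.congr_fun h3 w)))
  · have h1 := (hd (Sum.inr x)).hasMFDerivAt.comp x (hasMFDerivAt_inr (I := I) (M := M) (q' := x))
    have h3 := hasMFDerivAt_unique h1 (hg.1.mdifferentiable (by simp) x).hasMFDerivAt
    intro v w hvw
    exact hg.2 x
      ((DFunLike.congr_fun h3 v).symm.trans (Eq.trans hvw (DFunLike.congr_fun h3 w)))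

theorem IsSmoothImmersion.prodMap_id {g : N → K} (hg : IsSmoothImmersion I' I'' g) :
    IsSmoothImmersion (I.prod I') (I.prod I'') (Prod.map id g : M × N → M × K) := by
  refine ⟨contMDiff_id.prodMap hg.1, fun x => ?_⟩
  rw [mfderiv_prodMap mdifferentiableAt_id (hg.1.mdifferentiable (by simp) x.2)]
  rw [mfderiv_id]
  exact Function.Injective.prodMap Function.injective_id (hg.2 x.2)

/-- A smooth curve `[0, 1] → N` is immersed if a differentiable function maps it to a curve with
nowhere vanishing derivative. -/
theorem IsSmoothImmersion.of_comp_eq {F : Type*} [NormedAddCommGroup F] [NormedSpace ℝ F]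
    {g : Icc (0 : ℝ) 1 → N} (hg : ContMDiff (𝓡∂ 1) I' ∞ g) {h : N → F}
    (hh : MDifferentiable I' 𝓘(ℝ, F) h) {k k' : ℝ → F} (hk : ∀ z, HasDerivAt k (k' z) z)
    (hk' : ∀ z, k' z ≠ 0) (hcomp : ∀ z : Icc (0 : ℝ) 1, h (g z) = k z) :
    IsSmoothImmersion (𝓡∂ 1) I' g := by
  refine ⟨hg, fun z => ?_⟩
  have h1 := (hh (g z)).hasMFDerivAt.comp z (hg.mdifferentiable (by simp) z).hasMFDerivAt
  have h2 := (hk z).hasFDerivAt.hasMFDerivAt.comp z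
    (contMDiff_subtypeVal_Icc (n := ∞).mdifferentiable (by simp) z).hasMFDerivAt
  rw [show h ∘ g = k ∘ Subtype.val from funext hcomp] at h1
  have h3 := DFunLike.congr_fun (hasMFDerivAt_unique h1 h2) (1 : TangentSpace (𝓡∂ 1) z)
  -- By the chain rule `dh` sends this vector to `k' z`, which is nonzero. The tangent space of the
  -- interval is a line, so nonvanishing on one vector gives injectivity.
  have h4 : mfderiv (𝓡∂ 1) I' g z 1 ≠ 0 := by
    intro h0
    apply hk' z
    have h5 : mfderiv I' 𝓘(ℝ, F) h (g z) (mfderiv (𝓡∂ 1) I' g z 1) =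
        (ContinuousLinearMap.toSpanSingleton ℝ (k' z))
          (mfderiv (𝓡∂ 1) 𝓘(ℝ) (Subtype.val : Icc (0 : ℝ) 1 → ℝ) z 1) := h3
    rw [h0, mfderiv_subtypeVal_Icc_one, map_zero] at h5
    exact (h5.trans (one_smul ℝ (k' z))).symm
  have h6 : Module.finrank ℝ (TangentSpace (𝓡∂ 1) z) = 1 :=
    finrank_euclideanSpace_fin (𝕜 := ℝ) (n := 1)
  have h7 : (1 : TangentSpace (𝓡∂ 1) z) ≠ 0 := fun h => h4 (by rw [h, map_zero])
  refine (injective_iff_map_eq_zero _).2 fun v hv => ?_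
  obtain ⟨c, rfl⟩ := exists_smul_eq_of_finrank_eq_one h6 h7 v
  rw [map_smul, smul_eq_zero] at hv
  rcases hv with rfl | hv
  · exact zero_smul ℝ _
  · exact absurd hv h4

end Immersions

/-! ### Cutting the interval and the circle into two halves -/

section Halves

open scoped Manifold ContDiff

namespace unitInterval

/-- The map of `[0, 1]` onto its lower half. -/
noncomputable def lowerHalf (s : Icc (0 : ℝ) 1) : Icc (0 : ℝ) 1 :=
  ⟨s / 2, by linarith [s.2.1], by linarith [s.2.2]⟩

/-- The map of `[0, 1]` onto its upper half. -/
noncomputable def upperHalf (s : Icc (0 : ℝ) 1) : Icc (0 : ℝ) 1 :=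
  ⟨(1 + s) / 2, by linarith [s.2.1], by linarith [s.2.2]⟩

theorem isSmoothImmersion_lowerHalf : IsSmoothImmersion (𝓡∂ 1) (𝓡∂ 1) lowerHalf := by
  refine .of_comp_eq (h := Subtype.val) (k := fun r => r / 2) (k' := fun _ => 1 / 2)
    (contMDiff_iff_comp_subtypeVal_Icc.2 ⟨by unfold lowerHalf; fun_prop, ?_⟩)
    (contMDiff_subtypeVal_Icc (n := ∞).mdifferentiable (by simp))
    (fun z => (hasDerivAt_id z).div_const 2) (fun _ => by norm_num) (fun _ => rfl)
  have h : ContDiff ℝ ∞ fun r : ℝ => r / 2 := by fun_prop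
  exact h.contMDiff.comp contMDiff_subtypeVal_Icc

theorem isSmoothImmersion_upperHalf : IsSmoothImmersion (𝓡∂ 1) (𝓡∂ 1) upperHalf := by
  refine .of_comp_eq (h := Subtype.val) (k := fun r => (1 + r) / 2) (k' := fun _ => 1 / 2)
    (contMDiff_iff_comp_subtypeVal_Icc.2 ⟨by unfold upperHalf; fun_prop, ?_⟩)
    (contMDiff_subtypeVal_Icc (n := ∞).mdifferentiable (by simp))
    (fun z => ((hasDerivAt_id z).const_add 1).div_const 2) (fun _ => by norm_num) (fun _ => rfl)
  have h : ContDiff ℝ ∞ fun r : ℝ => (1 + r) / 2 := by fun_prop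
  exact h.contMDiff.comp contMDiff_subtypeVal_Icc

theorem lowerHalf_injective : Function.Injective lowerHalf := fun s t h => by
  have := congrArg Subtype.val h
  simp only [lowerHalf] at this
  exact Subtype.ext (by linarith)

theorem upperHalf_injective : Function.Injective upperHalf := fun s t h => by
  have := congrArg Subtype.val h
  simp only [upperHalf] at this
  exact Subtype.ext (by linarith)

theorem lowerHalf_eq_upperHalf {s t : Icc (0 : ℝ) 1} :
    lowerHalf s = upperHalf t ↔ s = 1 ∧ t = 0 := by
  simp only [lowerHalf, upperHalf, Subtype.ext_iff, Icc.coe_one, Icc.coe_zero]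
  have := s.2.2
  have := t.2.1
  constructor
  · intro h
    constructor <;> linarith
  · rintro ⟨h1, h2⟩
    rw [h1, h2]
    norm_num

theorem lowerHalf_eq_zero {s : Icc (0 : ℝ) 1} : lowerHalf s = 0 ↔ s = 0 := by
  rw [Subtype.ext_iff, Subtype.ext_iff]
  exact div_eq_zero_iff.trans (or_iff_left two_ne_zero)

theorem upperHalf_eq_one {s : Icc (0 : ℝ) 1} : upperHalf s = 1 ↔ s = 1 := by
  simp only [upperHalf, Subtype.ext_iff, Icc.coe_one]
  constructor <;> intro h <;> linarith

theorem lowerHalf_ne_one (s : Icc (0 : ℝ) 1) : lowerHalf s ≠ 1 := fun h => by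
  have := congrArg Subtype.val h
  simp only [lowerHalf, Icc.coe_one] at this
  linarith [s.2.2]

theorem upperHalf_ne_zero (s : Icc (0 : ℝ) 1) : upperHalf s ≠ 0 := fun h => by
  have := congrArg Subtype.val h
  simp only [upperHalf, Icc.coe_zero] at this
  linarith [s.2.1]

theorem exists_half (t : Icc (0 : ℝ) 1) : (∃ s, lowerHalf s = t) ∨ ∃ s, upperHalf s = t := by
  rcases le_total (t : ℝ) (1 / 2) with h | h
  · exact Or.inl ⟨⟨2 * t, by linarith [t.2.1], by linarith⟩, Subtype.ext (by simp [lowerHalf])⟩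
  · exact Or.inr ⟨⟨2 * t - 1, by linarith, by linarith [t.2.2]⟩, Subtype.ext (by simp [upperHalf])⟩

/-- The upper half of the circle. -/
noncomputable def upperArc (s : Icc (0 : ℝ) 1) : Circle := Circle.exp (Real.pi * s)

/-- The lower half of the circle. -/
noncomputable def lowerArc (s : Icc (0 : ℝ) 1) : Circle := Circle.exp (Real.pi * s + Real.pi)

theorem mdifferentiable_circle_coe : MDifferentiable (𝓡 1) 𝓘(ℝ, ℂ) (fun z : Circle => (z : ℂ)) :=
  haveI : Fact (Module.finrank ℝ ℂ = 1 + 1) := Complex.finrank_real_complex_fact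
  (contMDiff_coe_sphere (E := ℂ) (n := 1) (m := ∞)).mdifferentiable (by simp)

/-- The inclusion of the circle into `ℂ` serves as test function: there the curve has derivative
`πi` times a unit complex number. -/
theorem isSmoothImmersion_circleExp (c : ℝ) : IsSmoothImmersion (𝓡∂ 1) (𝓡 1)
    (fun s : Icc (0 : ℝ) 1 => Circle.exp (Real.pi * s + c)) := by
  refine .of_comp_eq (h := fun z : Circle => (z : ℂ))
    (k := fun r : ℝ => Complex.exp ((Real.pi * r + c : ℝ) * Complex.I))
    (k' := fun r : ℝ => Complex.exp ((Real.pi * r + c : ℝ) * Complex.I) *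
      ((Real.pi : ℝ) * Complex.I))
    ?_ mdifferentiable_circle_coe (fun z => ?_)
    (fun _ => by simp [Real.pi_ne_zero, Complex.exp_ne_zero]) (fun z => Circle.coe_exp _)
  · have h : ContDiff ℝ ∞ fun r : ℝ => Real.pi * r + c := by fun_prop
    exact contMDiff_circleExp.comp (h.contMDiff.comp contMDiff_subtypeVal_Icc)
  · have h1 : HasDerivAt (fun r : ℝ => Real.pi * r + c) Real.pi z := by
      simpa using ((hasDerivAt_id z).const_mul Real.pi).add_const c
    exact (h1.ofReal_comp.mul_const Complex.I).cexp

theorem isSmoothImmersion_upperArc : IsSmoothImmersion (𝓡∂ 1) (𝓡 1) upperArc := by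
  have h := isSmoothImmersion_circleExp 0
  simp only [add_zero] at h
  exact h

theorem isSmoothImmersion_lowerArc : IsSmoothImmersion (𝓡∂ 1) (𝓡 1) lowerArc :=
  isSmoothImmersion_circleExp Real.pi

theorem lowerArc_eq (s : Icc (0 : ℝ) 1) : lowerArc s = -upperArc s := by
  rw [lowerArc, upperArc, Circle.exp_add, Circle.exp_pi_eq_neg_one, mul_neg, mul_one]

theorem upperArc_injective : Function.Injective upperArc := fun s t h => by
  obtain ⟨m, hm⟩ := Circle.exp_eq_exp.1 h
  have h1 : (s : ℝ) = t + 2 * m := by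
    apply mul_left_cancel₀ Real.pi_ne_zero
    rw [hm]
    ring
  have h2 : (m : ℝ) < 1 := by linarith [s.2.2, t.2.1]
  have h3 : (-1 : ℝ) < m := by linarith [s.2.1, t.2.2]
  have h4 : m < 1 := by exact_mod_cast h2
  have h5 : -1 < m := by exact_mod_cast h3
  have h6 : m = 0 := by omega
  rw [h6] at h1
  exact Subtype.ext (by simpa using h1)

theorem lowerArc_injective : Function.Injective lowerArc := fun s t h => by
  rw [lowerArc_eq, lowerArc_eq, neg_inj] at h
  exact upperArc_injective h

theorem upperArc_zero : upperArc 0 = 1 := by simp [upperArc]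

theorem upperArc_one : upperArc 1 = -1 := by simp [upperArc, Circle.exp_pi_eq_neg_one]

/-- Equality of the angles `πs` and `πt + π` modulo `2π` means `s = t + 1 + 2m`. For `s, t ∈ [0, 1]`
only `m = 0` and `m = -1` remain, each attained at endpoints. -/
theorem upperArc_eq_lowerArc {s t : Icc (0 : ℝ) 1} :
    upperArc s = lowerArc t ↔ s = 0 ∧ t = 1 ∨ s = 1 ∧ t = 0 := by
  constructor
  · intro h
    obtain ⟨m, hm⟩ := Circle.exp_eq_exp.1 h
    have h1 : (s : ℝ) = t + 1 + 2 * m := by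
      apply mul_left_cancel₀ Real.pi_ne_zero
      rw [hm]
      ring
    have h2 : (m : ℝ) < 1 := by linarith [s.2.2, t.2.1]
    have h3 : (-2 : ℝ) < m := by linarith [s.2.1, t.2.2]
    have h4 : m < 1 := by exact_mod_cast h2
    have h5 : -2 < m := by exact_mod_cast h3
    have h6 : m = 0 ∨ m = -1 := by omega
    simp only [Subtype.ext_iff, Icc.coe_one, Icc.coe_zero]
    rcases h6 with rfl | rfl
    · right
      push_cast at h1
      constructor <;> linarith [s.2.2, t.2.1]
    · left
      push_cast at h1
      constructor <;> linarith [s.2.1, t.2.2]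
  · rintro (⟨rfl, rfl⟩ | ⟨rfl, rfl⟩) <;> simp [lowerArc_eq, upperArc_zero, upperArc_one]

theorem exists_arc (c : Circle) : (∃ s, upperArc s = c) ∨ ∃ s, lowerArc s = c := by
  obtain ⟨r, rfl⟩ := Circle.exp_surjective c
  have hr : Circle.exp (toIcoMod Real.two_pi_pos 0 r) = Circle.exp r := by
    rw [Circle.exp_eq_exp]
    exact ⟨-toIcoDiv Real.two_pi_pos 0 r, by rw [toIcoMod, zsmul_eq_mul]; push_cast; ring⟩
  obtain ⟨h0, h1⟩ := toIcoMod_mem_Ico Real.two_pi_pos 0 r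
  rw [← hr]
  generalize toIcoMod Real.two_pi_pos 0 r = r at h0 h1
  have hpi := Real.pi_pos
  rcases le_total r Real.pi with h | h
  · refine Or.inl ⟨⟨r / Real.pi, by positivity, by rwa [div_le_one hpi]⟩, ?_⟩
    rw [upperArc, mul_div_cancel₀ _ hpi.ne']
  · refine Or.inr ⟨⟨(r - Real.pi) / Real.pi, div_nonneg (by linarith) hpi.le, ?_⟩, ?_⟩
    · rw [div_le_one hpi]
      linarith
    · rw [lowerArc, mul_div_cancel₀ _ hpi.ne', sub_add_cancel]

end unitInterval

end Halves

/-! ### Bent cylinders and their gluings -/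

section Bordisms

open scoped Manifold ContDiff
open unitInterval

variable {n : ℕ}

namespace ThickBordism

/-- The cylinder `M × [0, 1]` with both ends outgoing. -/
noncomputable def copairing (M : PointedManifold n) : ThickBordism (.empty n) (M.sum M) where
  carrier := M.carrier × Icc (0 : ℝ) 1
  orientable := M.orientable.prod isOrientable_Icc
  inn := fun x => isEmptyElim x
  out := Sum.elim (fun x => (x, 0)) (fun x => (x, 1))
  inn_immersion := IsSmoothImmersion.of_isEmpty _
  out_immersion := (IsSmoothImmersion.prodMk_const _).sumElim (IsSmoothImmersion.prodMk_const _)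
  inn_injective := fun x => isEmptyElim x
  out_injective := by
    rintro (x | x) (y | y) h
    · exact congrArg Sum.inl (congrArg Prod.fst h)
    · exact absurd (congrArg Prod.snd h) zero_ne_one
    · exact absurd (congrArg Prod.snd h) one_ne_zero
    · exact congrArg Sum.inr (congrArg Prod.fst h)
  inn_ne_out := fun x => isEmptyElim x
  boundary_eq := by
    have h : range (fun x : (PointedManifold.empty n).carrier =>
        (isEmptyElim x : M.carrier × Icc (0 : ℝ) 1)) = ∅ := range_eq_empty _
    rw [h, empty_union]
    exact (cylinder M).boundary_eq.trans (Set.Sum.elim_range _ _).symm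
  basepoints := M.basepoints ×ˢ {0, 1}
  finite_basepoints := (cylinder M).finite_basepoints
  nonempty_basepoints := (cylinder M).nonempty_basepoints
  inn_mem := fun x => isEmptyElim x
  out_mem := by
    rintro (x | x)
    · exact (cylinder M).inn_mem x
    · exact (cylinder M).out_mem x

/-- The cylinder `M × [0, 1]` with both ends incoming. -/
noncomputable def pairing (M : PointedManifold n) : ThickBordism (M.sum M) (.empty n) where
  carrier := M.carrier × Icc (0 : ℝ) 1
  orientable := M.orientable.prod isOrientable_Icc
  inn := (copairing M).out
  out := fun x => isEmptyElim x
  inn_immersion := (copairing M).out_immersion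
  out_immersion := IsSmoothImmersion.of_isEmpty _
  inn_injective := (copairing M).out_injective
  out_injective := fun x => isEmptyElim x
  inn_ne_out := fun _ x => isEmptyElim x
  boundary_eq := (copairing M).boundary_eq.trans (union_comm _ _ |>.trans
    (congrArg _ ((range_eq_empty _).trans (range_eq_empty _).symm)))
  basepoints := M.basepoints ×ˢ {0, 1}
  finite_basepoints := (cylinder M).finite_basepoints
  nonempty_basepoints := (cylinder M).nonempty_basepoints
  inn_mem := (copairing M).out_mem
  out_mem := fun x => isEmptyElim x

/-- The cylinder `M × [0, 1]` with basepoints at the two ends and in the middle. -/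
noncomputable def doubleCylinder (M : PointedManifold n) : ThickBordism M M :=
  { cylinder M with
    -- `upperHalf 0` is the level `1/2`, in the form in which it arises from the gluing.
    basepoints := M.basepoints ×ˢ {0, upperHalf 0, 1}
    finite_basepoints := M.finite_basepoints.prod (by simp)
    nonempty_basepoints := by
      rintro ⟨x, _⟩
      obtain ⟨a, ha, -⟩ := M.meets_component x
      exact ⟨(a, 0), ha, by simp⟩
    inn_mem := fun p => and_iff_left (Or.inl rfl)
    out_mem := fun p => and_iff_left (Or.inr (Or.inr rfl)) }

end ThickBordism

namespace Bdp

open Bordism PointedManifold ThickBordism MonoidalCategory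

variable {A B B' C M : PointedManifold n}

/-- A gluing of bordisms without thin part. -/
theorem mk_ofThick_comp {W₁ : ThickBordism A B} {W₂ : ThickBordism B' C} {W₃ : ThickBordism A C}
    (f : B.Iso B') {a : W₁.carrier → W₃.carrier} {b : W₂.carrier → W₃.carrier}
    (ha : IsSmoothImmersion (bordismModel n) (bordismModel n) a)
    (hb : IsSmoothImmersion (bordismModel n) (bordismModel n) b)
    (a_inj : Function.Injective a) (b_inj : Function.Injective b)
    (cover : ∀ z, (∃ x, a x = z) ∨ ∃ y, b y = z)
    (meet : ∀ x y, a x = b y ↔ ∃ l, W₁.out l = x ∧ W₂.inn (f l) = y)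
    (inn_eq : ∀ m, W₃.inn m = a (W₁.inn m)) (out_eq : ∀ k, W₃.out k = b (W₂.out k))
    (basepoints_eq : ∀ z, z ∈ W₃.basepoints ↔
      (∃ x ∈ W₁.basepoints, a x = z) ∨ ∃ y ∈ W₂.basepoints, b y = z) :
    mk (ofThick W₁) ≫ mk (thin f) ≫ mk (ofThick W₂) = mk (ofThick W₃) := by
  -- The diffeomorphism `f` is absorbed into the incoming boundary of `W₂`; what remains is a gluing
  -- of bordisms whose thin parts are empty.
  rw [thin_comp_mk]
  refine mk_comp_mk ⟨⟨a, fun x => isEmptyElim (α := (PointedManifold.empty n).carrier) x, b,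
    fun x => isEmptyElim (α := (PointedManifold.empty n).carrier) x, ha, hb, ?_, ?_, ?_, ?_, ?_,
    ?_, ?_⟩⟩
  · rintro (x | x) (y | y) h
    · exact congrArg Sum.inl (a_inj (Sum.inl_injective h))
    all_goals exact isEmptyElim (α := (PointedManifold.empty n).carrier) ‹_›
  · rintro (x | x) (y | y) h
    · exact congrArg Sum.inl (b_inj (Sum.inl_injective h))
    all_goals exact isEmptyElim (α := (PointedManifold.empty n).carrier) ‹_›
  · rintro (z | z)
    · rcases cover z with ⟨x, hx⟩ | ⟨y, hy⟩
      · exact Or.inl ⟨Sum.inl x, congrArg Sum.inl hx⟩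
      · exact Or.inr ⟨Sum.inl y, congrArg Sum.inl hy⟩
    · exact isEmptyElim (α := (PointedManifold.empty n).carrier) z
  · rintro (x | x) (y | y)
    · constructor
      · intro h
        obtain ⟨l, hl, hl'⟩ := (meet x y).1 (Sum.inl_injective h)
        exact ⟨l, congrArg Sum.inl hl, congrArg Sum.inl hl'⟩
      · rintro ⟨l, hl, hl'⟩
        exact congrArg Sum.inl ((meet x y).2 ⟨l, Sum.inl_injective hl, Sum.inl_injective hl'⟩)
    all_goals exact isEmptyElim (α := (PointedManifold.empty n).carrier) ‹_›
  · exact fun m => congrArg Sum.inl (inn_eq m)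
  · exact fun k => congrArg Sum.inl (out_eq k)
  · rintro (z | z)
    · refine (basepoints_eq z).trans (or_congr ?_ ?_)
      · constructor
        · rintro ⟨x, hx, h⟩
          exact ⟨Sum.inl x, hx, congrArg Sum.inl h⟩
        · rintro ⟨x | x, hx, h⟩
          · exact ⟨x, hx, Sum.inl_injective h⟩
          · exact isEmptyElim (α := (PointedManifold.empty n).carrier) x
      · constructor
        · rintro ⟨x, hx, h⟩
          exact ⟨Sum.inl x, hx, congrArg Sum.inl h⟩
        · rintro ⟨x | x, hx, h⟩
          · exact ⟨x, hx, Sum.inl_injective h⟩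
          · exact isEmptyElim (α := (PointedManifold.empty n).carrier) x
    · exact isEmptyElim (α := (PointedManifold.empty n).carrier) z

/-- The level `1/2` is the top of the lower half and the bottom of the upper half, so four families
of basepoints yield three levels. Both the square of the twist and the snake use this count. -/
theorem doubleCylinder_basepoints (z : M.carrier × Icc (0 : ℝ) 1) :
    z ∈ (doubleCylinder M).basepoints ↔
      (∃ x ∈ M.basepoints ×ˢ {0, 1}, Prod.map id lowerHalf x = z) ∨
        ∃ y ∈ M.basepoints ×ˢ {0, 1}, Prod.map id upperHalf y = z := by
  have h0 : lowerHalf 0 = 0 := lowerHalf_eq_zero.2 rfl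
  have h1 : upperHalf 1 = 1 := upperHalf_eq_one.2 rfl
  have h2 : lowerHalf 1 = upperHalf 0 := lowerHalf_eq_upperHalf.2 ⟨rfl, rfl⟩
  obtain ⟨m, s⟩ := z
  constructor
  · rintro ⟨hm, hs | hs | hs⟩
    · exact Or.inl ⟨(m, 0), ⟨hm, Or.inl rfl⟩, Prod.ext rfl (h0.trans hs.symm)⟩
    · exact Or.inr ⟨(m, 0), ⟨hm, Or.inl rfl⟩, Prod.ext rfl hs.symm⟩
    · exact Or.inr ⟨(m, 1), ⟨hm, Or.inr rfl⟩, Prod.ext rfl (h1.trans hs.symm)⟩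
  · rintro (⟨⟨m, t⟩, ⟨hm, rfl | rfl⟩, h⟩ | ⟨⟨m, t⟩, ⟨hm, rfl | rfl⟩, h⟩) <;> rw [← h]
    · exact ⟨hm, Or.inl h0⟩
    · exact ⟨hm, Or.inr (Or.inl h2)⟩
    · exact ⟨hm, Or.inr (Or.inl rfl)⟩
    · exact ⟨hm, Or.inr (Or.inr h1)⟩

theorem exists_prodMap_half (z : M.carrier × Icc (0 : ℝ) 1) :
    (∃ x, Prod.map id lowerHalf x = z) ∨
      ∃ y : M.carrier × Icc (0 : ℝ) 1, Prod.map id upperHalf y = z := by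
  rcases exists_half z.2 with ⟨s, hs⟩ | ⟨s, hs⟩
  · exact Or.inl ⟨(z.1, s), Prod.ext rfl hs⟩
  · exact Or.inr ⟨(z.1, s), Prod.ext rfl hs⟩

/-- The two cylinders are rescaled to the halves of one. Gluing retains the basepoints on the common
end, which is why the middle level appears. -/
theorem twist_comp_twist (M : PointedManifold n) :
    twist M ≫ twist M = mk (ofThick (doubleCylinder M)) := by
  rw [← mk_ofThick_comp (W₁ := cylinder M) (W₂ := cylinder M) (W₃ := doubleCylinder M) (.refl M)
    (a := Prod.map id lowerHalf) (b := Prod.map id upperHalf)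
    isSmoothImmersion_lowerHalf.prodMap_id isSmoothImmersion_upperHalf.prodMap_id
    (Function.injective_id.prodMap lowerHalf_injective)
    (Function.injective_id.prodMap upperHalf_injective) exists_prodMap_half ?_ ?_ ?_
    doubleCylinder_basepoints, thin_refl, Category.id_comp]
  · rfl
  · rintro ⟨m, s⟩ ⟨m', s'⟩
    constructor
    · intro h
      obtain ⟨rfl, rfl⟩ := lowerHalf_eq_upperHalf.1 (congrArg Prod.snd h)
      have h1 : m = m' := congrArg Prod.fst h
      subst h1
      exact ⟨m, rfl, rfl⟩
    · rintro ⟨l, h, h'⟩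
      rw [← h, ← h']
      exact Prod.ext rfl (lowerHalf_eq_upperHalf.2 ⟨rfl, rfl⟩)
  · exact fun m => Prod.ext rfl (lowerHalf_eq_zero.2 rfl).symm
  · exact fun m => Prod.ext rfl (upperHalf_eq_one.2 rfl).symm

/-- Gluing the two ends of `M × [0, 1]` gives `M × S¹`. -/
theorem copairing_comp_pairing (M : PointedManifold n) (W : ThickBordism (.empty n) (.empty n))
    (Φ : Diffeomorph ((𝓡 n).prod (𝓡 1)) (bordismModel n) (M.carrier × Circle) W.carrier ∞)
    (hΦ : W.basepoints = Φ '' (M.basepoints ×ˢ {1, -1})) :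
    mk (ofThick (copairing M)) ≫ mk (thin (Iso.sumComm M M)) ≫ mk (ofThick (pairing M)) =
      closed W := by
  have hΦi : IsSmoothImmersion ((𝓡 n).prod (𝓡 1)) (bordismModel n) Φ :=
    ⟨Φ.contMDiff, fun x => (Φ.mfderivToContinuousLinearEquiv (by simp) x).injective⟩
  have hmem : ∀ z, Φ z ∈ W.basepoints ↔ z ∈ M.basepoints ×ˢ {1, -1} := fun z => by
    rw [hΦ]
    exact Φ.injective.mem_set_image
  -- The copairing becomes the upper arc, from `1` to `-1`, and the pairing the lower arc, from `-1`
  -- to `1`. End `0` of each thus meets end `1` of the other, which is the swap in the middle.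
  refine mk_ofThick_comp (W₁ := copairing M) (W₂ := pairing M) (W₃ := W) (Iso.sumComm M M)
    (a := Φ ∘ Prod.map id upperArc) (b := Φ ∘ Prod.map id lowerArc)
    (hΦi.comp isSmoothImmersion_upperArc.prodMap_id)
    (hΦi.comp isSmoothImmersion_lowerArc.prodMap_id)
    (Φ.injective.comp (Function.injective_id.prodMap upperArc_injective))
    (Φ.injective.comp (Function.injective_id.prodMap lowerArc_injective)) ?_ ?_
    (fun x => isEmptyElim (α := (PointedManifold.empty n).carrier) x)
    (fun x => isEmptyElim (α := (PointedManifold.empty n).carrier) x) ?_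
  · intro z
    obtain ⟨⟨m, c⟩, rfl⟩ := Φ.surjective z
    rcases exists_arc c with ⟨s, rfl⟩ | ⟨s, rfl⟩
    · exact Or.inl ⟨(m, s), rfl⟩
    · exact Or.inr ⟨(m, s), rfl⟩
  · rintro ⟨m, s⟩ ⟨m', s'⟩
    constructor
    · intro h
      have h' := Φ.injective h
      have h1 : m = m' := congrArg Prod.fst h'
      subst h1
      rcases upperArc_eq_lowerArc.1 (congrArg Prod.snd h') with ⟨rfl, rfl⟩ | ⟨rfl, rfl⟩
      · exact ⟨Sum.inl m, rfl, rfl⟩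
      · exact ⟨Sum.inr m, rfl, rfl⟩
    · rintro ⟨l | l, h, h'⟩ <;> rw [← h, ← h']
      · exact congrArg Φ (Prod.ext rfl (upperArc_eq_lowerArc.2 (Or.inl ⟨rfl, rfl⟩)))
      · exact congrArg Φ (Prod.ext rfl (upperArc_eq_lowerArc.2 (Or.inr ⟨rfl, rfl⟩)))
  · intro z
    obtain ⟨⟨m, c⟩, rfl⟩ := Φ.surjective z
    refine (hmem (m, c)).trans ?_
    have h0 : lowerArc 0 = -1 := by rw [lowerArc_eq, upperArc_zero]
    have h1 : lowerArc 1 = 1 := by rw [lowerArc_eq, upperArc_one, neg_neg]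
    constructor
    · rintro ⟨hm, hc | hc⟩
      · exact Or.inl ⟨(m, 0), ⟨hm, Or.inl rfl⟩, congrArg Φ (Prod.ext rfl (upperArc_zero.trans hc.symm))⟩
      · exact Or.inl ⟨(m, 1), ⟨hm, Or.inr rfl⟩, congrArg Φ (Prod.ext rfl (upperArc_one.trans hc.symm))⟩
    · rintro (⟨⟨m', t⟩, ⟨hm, rfl | rfl⟩, h⟩ | ⟨⟨m', t⟩, ⟨hm, rfl | rfl⟩, h⟩) <;>
        rw [← Φ.injective h]
      · exact ⟨hm, Or.inl upperArc_zero⟩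
      · exact ⟨hm, Or.inr upperArc_one⟩
      · exact ⟨hm, Or.inr h0⟩
      · exact ⟨hm, Or.inl h1⟩

/-- The bordism `M × [0, 1]` with three levels of basepoints, from `M ⊔ ∅` to `∅ ⊔ M`. -/
noncomputable def bentCylinder (M : PointedManifold n) :
    Bordism (M.sum (.empty n)) ((PointedManifold.empty n).sum M) :=
  ⟨M, M, .empty n, doubleCylinder M, .refl _, (Iso.emptySum M).trans (Iso.sumEmpty M).symm⟩

/-- The unitors only relabel the ends by discarding an empty summand, so the identity of the
underlying cylinder is the required diffeomorphism. -/
theorem bentCylinder_comp (M : PointedManifold n) :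
    mk (bentCylinder M) ≫ mk (thin (Iso.emptySum M)) =
      mk (thin (Iso.sumEmpty M)) ≫ mk (ofThick (doubleCylinder M)) := by
  refine mk_comp_thin ⟨Diffeomorph.refl _ _ _, Equiv.refl _, ?_, ?_, ?_⟩
  · rintro (m | x)
    · rfl
    · exact isEmptyElim (α := (PointedManifold.empty n).carrier) x
  · rintro (x | m)
    · exact isEmptyElim (α := (PointedManifold.empty n).carrier) x
    · rfl
  · rintro (x | x)
    · rfl
    · exact isEmptyElim (α := (PointedManifold.empty n).carrier) x

/-- This is the straightening of the snake. The copairing fills the upper half of `M × [0, 1]`, the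
pairing the lower half, and the two thin strands have length zero: they collapse onto the two ends.
-/
theorem gluing_bentCylinder (M : PointedManifold n) :
    Nonempty (Gluing ((thin (.refl M)).sum (ofThick (copairing M)))
      (precomp (Iso.sumAssoc M M M).symm ((ofThick (pairing M)).sum (thin (.refl M))))
      (bentCylinder M)) := by
  let X := (thin (.refl M)).sum (ofThick (copairing M))
  let Y := precomp (Iso.sumAssoc M M M).symm ((ofThick (pairing M)).sum (thin (.refl M)))
  let Z := bentCylinder M
  have hM : ∀ x : (PointedManifold.empty n).carrier, False := fun x => isEmptyElim x
  have hT : ∀ x : (thin (.refl M) : Bordism M M).thick.carrier, False :=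
    (isEmpty_thin M M (.refl M)).false
  let a : X.thick.carrier → Z.thick.carrier :=
    Sum.elim (fun x => (hT x).elim) (Prod.map id upperHalf)
  let b : Y.thick.carrier → Z.thick.carrier :=
    Sum.elim (Prod.map id lowerHalf) (fun x => (hT x).elim)
  -- The strand beside the copairing becomes the incoming end at level `0`, the one beside the
  -- pairing the outgoing end at level `1`.
  let α : X.N.carrier → Z.Total := Sum.elim (fun m => Sum.inl (m, 0)) (fun x => (hM x).elim)
  let β : Y.N.carrier → Z.Total := Sum.elim (fun x => (hM x).elim) (fun m => Sum.inl (m, 1))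
  have ha : IsSmoothImmersion (bordismModel n) (bordismModel n) a :=
    haveI := isEmpty_thin M M (.refl M)
    (IsSmoothImmersion.of_isEmpty _).sumElim isSmoothImmersion_upperHalf.prodMap_id
  have hb : IsSmoothImmersion (bordismModel n) (bordismModel n) b :=
    haveI := isEmpty_thin M M (.refl M)
    isSmoothImmersion_lowerHalf.prodMap_id.sumElim (IsSmoothImmersion.of_isEmpty _)
  -- Case analysis on the points of `X`, and below of `Y`, that discards the empty summands: one
  -- half cylinder and one thin strand remain.
  have hX : ∀ {P : X.Total → Prop}, (∀ m s, P (Sum.inl (Sum.inr (m, s)))) →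
      (∀ m, P (Sum.inr (Sum.inl m))) → ∀ x, P x := by
    rintro P h1 h2 ((x | ⟨m, s⟩) | (m | x))
    · exact (hT x).elim
    · exact h1 m s
    · exact h2 m
    · exact (hM x).elim
  have hY : ∀ {P : Y.Total → Prop}, (∀ m s, P (Sum.inl (Sum.inl (m, s)))) →
      (∀ m, P (Sum.inr (Sum.inr m))) → ∀ x, P x := by
    rintro P h1 h2 ((⟨m, s⟩ | x) | (x | m))
    · exact h1 m s
    · exact (hT x).elim
    · exact (hM x).elim
    · exact h2 m
  have inj : ∀ {m m' : M.carrier} {s s' : Icc (0 : ℝ) 1},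
      (Sum.inl (m, s) : Z.Total) = Sum.inl (m', s') → m = m' ∧ s = s' := fun h =>
    ⟨congrArg Prod.fst (Sum.inl_injective h), congrArg Prod.snd (Sum.inl_injective h)⟩
  refine ⟨⟨a, α, b, β, ha, hb, ?_, ?_, ?_, ?_, ?_, ?_, ?_⟩⟩
  · refine hX (fun m s => hX (fun m' s' h => ?_) fun m' h => ?_)
      fun m => hX (fun m' s' h => ?_) fun m' h => ?_
    · obtain ⟨rfl, h2⟩ := inj h
      rw [upperHalf_injective h2]
      rfl
    · exact absurd (inj h).2 (upperHalf_ne_zero _)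
    · exact absurd (inj h).2.symm (upperHalf_ne_zero _)
    · rw [(inj h).1]
  · refine hY (fun m s => hY (fun m' s' h => ?_) fun m' h => ?_)
      fun m => hY (fun m' s' h => ?_) fun m' h => ?_
    · obtain ⟨rfl, h2⟩ := inj h
      rw [lowerHalf_injective h2]
      rfl
    · exact absurd (inj h).2 (lowerHalf_ne_one _)
    · exact absurd (inj h).2.symm (lowerHalf_ne_one _)
    · rw [(inj h).1]
  · rintro (⟨m, t⟩ | x)
    · rcases exists_half t with ⟨s, rfl⟩ | ⟨s, rfl⟩
      · exact Or.inr ⟨Sum.inl (Sum.inl (m, s)), rfl⟩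
      · exact Or.inl ⟨Sum.inl (Sum.inr (m, s)), rfl⟩
    · exact (hM x).elim
  -- The three copies of `M` in the middle object are glued at the levels `0`, `1/2` and `1`.
  · have meet : ∀ l, totalMap a α (X.out l) = totalMap b β (Y.inn l) := by
      rintro (m | m | m)
      · exact congrArg Sum.inl (Prod.ext rfl (lowerHalf_eq_zero.2 rfl).symm)
      · exact congrArg Sum.inl (Prod.ext rfl (lowerHalf_eq_upperHalf.2 ⟨rfl, rfl⟩).symm)
      · exact congrArg Sum.inl (Prod.ext rfl (upperHalf_eq_one.2 rfl))
    intro x y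
    constructor
    · revert x y
      refine hX (fun m s => hY (fun m' s' h => ?_) fun m' h => ?_)
        fun m => hY (fun m' s' h => ?_) fun m' h => ?_
      · obtain ⟨rfl, h2⟩ := inj h
        obtain ⟨rfl, rfl⟩ := lowerHalf_eq_upperHalf.1 h2.symm
        exact ⟨Sum.inr (Sum.inl m), rfl, rfl⟩
      · obtain ⟨rfl, h2⟩ := inj h
        obtain rfl := upperHalf_eq_one.1 h2
        exact ⟨Sum.inr (Sum.inr m), rfl, rfl⟩
      · obtain ⟨rfl, h2⟩ := inj h
        obtain rfl := lowerHalf_eq_zero.1 h2.symm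
        exact ⟨Sum.inl m, rfl, rfl⟩
      · exact absurd (inj h).2 zero_ne_one
    · rintro ⟨l, rfl, rfl⟩
      exact meet l
  · rintro (m | x)
    · rfl
    · exact (hM x).elim
  · rintro (x | m)
    · exact (hM x).elim
    · rfl
  · rintro (z | x)
    · refine (doubleCylinder_basepoints z).trans ⟨?_, ?_⟩
      · rintro (⟨⟨m, s⟩, h, h'⟩ | ⟨⟨m, s⟩, h, h'⟩)
        · exact Or.inr ⟨Sum.inl (Sum.inl (m, s)), h, congrArg Sum.inl h'⟩
        · exact Or.inl ⟨Sum.inl (Sum.inr (m, s)), h, congrArg Sum.inl h'⟩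
      · rintro (⟨x, hx, h⟩ | ⟨y, hy, h⟩)
        · revert x
          refine hX (fun m s hx h => ?_) fun m hx h => ?_
          · exact Or.inr ⟨(m, s), hx, Sum.inl_injective h⟩
          -- The basepoints of a collapsed strand add nothing new: those at level `0` already come
          -- from the lower half, and symmetrically those at level `1` from the upper half.
          · exact Or.inl ⟨(m, 0), ⟨hx, Or.inl rfl⟩,
              (congrArg (Prod.mk m) (lowerHalf_eq_zero.2 rfl)).trans
                (Sum.inl_injective (a₁ := (m, (0 : Icc (0 : ℝ) 1))) h)⟩
        · revert y
          refine hY (fun m s hx h => ?_) fun m hx h => ?_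
          · exact Or.inl ⟨(m, s), hx, Sum.inl_injective h⟩
          · exact Or.inr ⟨(m, 1), ⟨hx, Or.inr rfl⟩,
              (congrArg (Prod.mk m) (upperHalf_eq_one.2 rfl)).trans
                (Sum.inl_injective (a₁ := (m, (1 : Icc (0 : ℝ) 1))) h)⟩
    · exact (hM x).elim

end Bdp

end Bordisms

/-! ### The snake identity in the bordism category -/

namespace Bdp

open Bordism PointedManifold ThickBordism MonoidalCategory

variable {n : ℕ}

/-- The snake identity: the copairing and the pairing compose to the square of the twist. -/
theorem snake_eq_twist_comp_twist (M : PointedManifold n) :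
    (ρ_ (of M)).inv ≫ (of M ◁ mk (ofThick (copairing M))) ≫ (α_ (of M) (of M) (of M)).inv ≫
      (mk (ofThick (pairing M)) ▷ of M) ≫ (λ_ (of M)).hom = twist M ≫ twist M := by
  rw [Iso.inv_comp_eq, whiskerLeft_mk, whiskerRight_mk, twist_comp_twist]
  refine Eq.trans ?_ (bentCylinder_comp M)
  -- The inverse associator is the reidentification of the incoming boundary built into the second
  -- factor of the gluing.
  rw [← mk_comp_mk (gluing_bentCylinder M), ← thin_comp_mk]
  simp only [Category.assoc]
  rfl

end Bdp

/-! ### The closed manifold `M × S¹` with two basepoints -/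

section

open scoped Manifold ContDiff
open Bordism PointedManifold ThickBordism

variable {n : ℕ} {M : Type} [TopologicalSpace M] [ChartedSpace (EuclideanSpace ℝ (Fin n)) M]
  [IsManifold (𝓡 n) ∞ M] [CompactSpace M] [T2Space M] [ConnectedSpace M]

/-- In the bordism category, `M × S¹` with any two distinct basepoints is the composite of a
copairing and a pairing. -/
theorem ThickBordism.IsProdCircle.closed_eq (hM : IsOrientable (𝓡 n) M) (p : M) {x₁ x₂ : M × Circle}
    (hx : x₁ ≠ x₂) {W : ThickBordism (.empty n) (.empty n)} (hW : W.IsProdCircle M x₁ x₂) :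
    Bdp.mk (ofThick (copairing (.single M hM p))) ≫
      Bdp.mk (thin (Iso.sumComm (.single M hM p) (.single M hM p))) ≫
        Bdp.mk (ofThick (pairing (.single M hM p))) = Bdp.closed W := by
  obtain ⟨Φ, hΦ⟩ := hW
  -- Reparametrising `M × S¹` by `Ψ` moves the basepoints to `(p, 1)` and `(p, -1)`, where the two
  -- arcs are glued.
  obtain ⟨Ψ, h1, h2⟩ := diffeoRel_prodCircle (I := 𝓡 n) p hx
  refine Bdp.copairing_comp_pairing (.single M hM p) W (Ψ.symm.trans Φ) ?_
  have h3 : (({p} : Set M) ×ˢ ({1, -1} : Set Circle)) = Ψ '' {x₁, x₂} := by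
    rw [image_pair, h1, h2]
    ext ⟨q, c⟩
    simp only [mem_prod, mem_singleton_iff, mem_insert_iff, Prod.mk.injEq]
    tauto
  have h4 : (Ψ.symm.trans Φ) '' (({p} : Set M) ×ˢ ({1, -1} : Set Circle)) = Φ '' {x₁, x₂} := by
    rw [h3, image_image]
    exact image_congr fun x _ => congrArg Φ (Ψ.symm_apply_apply x)
  exact hΦ.trans h4.symm

end

/-! ### The main theorem -/

open scoped Manifold ContDiff
theorem mainTheorem7 (n : ℕ) (R : Type u) [CommRing R]
    (Z : Bdp n ⥤ ModuleCat.{u} R) [Z.Braided]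
    (M : Type) [TopologicalSpace M] [ChartedSpace (EuclideanSpace ℝ (Fin n)) M]
    [IsManifold (𝓡 n) ∞ M] [CompactSpace M] [T2Space M] [ConnectedSpace M]
    (hM : IsOrientable (𝓡 n) M) (p : M) :
    (∃ t : R,
      HasTrace (Z.map (Bdp.twist (.single M hM p) ≫ Bdp.twist (.single M hM p))).hom t ∧
      (IsDomain R ∨ Module.Projective R (Z.obj (.of (.single M hM p))) →
        ∀ s : R, HasTrace (Z.map (Bdp.twist (.single M hM p) ≫ Bdp.twist (.single M hM p))).hom s →
          s = t) ∧
      (Module.Free R (Z.obj (.of (.single M hM p))) →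
        Module.Finite R (Z.obj (.of (.single M hM p))) →
        LinearMap.trace R (Z.obj (.of (.single M hM p)))
          (Z.map (Bdp.twist (.single M hM p) ≫ Bdp.twist (.single M hM p))).hom = t) ∧
      ∀ x₁ x₂ : M × Circle, x₁ ≠ x₂ →
        ∀ W : ThickBordism (.empty n) (.empty n), W.IsProdCircle M x₁ x₂ →
          ∀ r : R, Bdp.value Z (Bdp.closed W) r = t * r) ∧
    (IsDomain R → ∀ θ : R, Bdp.IsSplit Z θ →
      ∃ m : ℕ, ∀ x₁ x₂ : M × Circle, x₁ ≠ x₂ →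
        ∀ W : ThickBordism (.empty n) (.empty n), W.IsProdCircle M x₁ x₂ →
          ∀ r : R, Bdp.value Z (Bdp.closed W) r = (m : R) * θ ^ 2 * r) := by
  let P : PointedManifold n := .single M hM p
  have htr := hasTrace_map_snake Z (X := .of P)
    (Bdp.mk (Bordism.ofThick (ThickBordism.copairing P)))
    (Bdp.mk (Bordism.ofThick (ThickBordism.pairing P)))
  rw [Bdp.snake_eq_twist_comp_twist] at htr
  have hval : ∀ x₁ x₂ : M × Circle, x₁ ≠ x₂ →
      ∀ W : ThickBordism (.empty n) (.empty n), W.IsProdCircle M x₁ x₂ →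
        ∀ r : R, Bdp.value Z (Bdp.closed W) r = Bdp.value Z
          (Bdp.mk (Bordism.ofThick (ThickBordism.copairing P)) ≫
            (BraidedCategory.braiding (Bdp.of P) (Bdp.of P)).hom ≫
              Bdp.mk (Bordism.ofThick (ThickBordism.pairing P))) (1 : R) * r := by
    intro x₁ x₂ hx W hW r
    -- All the closed bordisms in question are the same morphism, and an `R`-linear map `R → R` is
    -- multiplication by its value at `1`.
    rw [← hW.closed_eq hM p hx, mul_comm, ← smul_eq_mul, ← map_smul, smul_eq_mul, mul_one]
    rfl
  refine ⟨⟨_, htr, fun h s hs => ?_, fun _ _ => htr.eq_trace, hval⟩, fun hR θ hθ => ?_⟩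
  · rcases h with h | h
    · exact hs.unique_of_isDomain htr
    · exact hs.unique_of_projective htr
  · have hg : (Z.map (Bdp.twist P)).hom ∘ₗ (Z.map (Bdp.twist P)).hom =
        θ • (Z.map (Bdp.twist P)).hom := by
      have h := congrArg ModuleCat.Hom.hom (hθ M hM p)
      rw [Functor.map_comp] at h
      exact h
    rw [Functor.map_comp] at htr
    -- The integer comes from the single trace `t`, hence it does not depend on the two basepoints.
    obtain ⟨m, hm⟩ := HasTrace.exists_eq_natCast_mul_sq hg htr
    refine ⟨m, fun x₁ x₂ hx W hW r => ?_⟩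
    rw [← hm]
    exact hval x₁ x₂ hx W hW r
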